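/- **Setting (latent contextual bandit).** Let $\mathcal A=[K]$ be the finite set of actions, $\mathcal X$ the measurable space of contexts, $\mathcal S$ a finite non-empty set of latent states and $\Theta$ a (standard Borel) space of model parameters. For every $(a,x,s,\theta)$ let $P(\cdot\mid a,x,s,\theta)$ be a reward distribution on $\mathbb R$ (measurable in $(a,x,s,\theta)$), with mean $\mu(a,x,s,\theta)$. Assume: 1. rewards are $\sigma^2$-sub-Gaussian: $\mathbb E_{R\sim P(\cdot\mid a,x,s,\theta)}\big[e^{\lambda(R-\mu(a,x,s,\theta))}\big]\le e^{\sigma^2\lambda^2/2}$ for all $\lambda\in\mathbb R$ and all $a,x,s,\theta$; 2. the suboptimality of any action is at most $1$: $\mu(a',x,s,\theta)-\mu(a,x,s,\theta)\le 1$ for all $a,a',x,s,\theta$; 3. mean rewards are normalized so that changing the state and the model changes the mean reward of a fixed action in a fixed context by at most $1$: $|\mu(a,x,s,\theta)-\mu(a,x,s',\theta')|\le 1$ for all $a,x,s,s',\theta,\theta'$ (2 and 3 both hold for instance if all mean rewards lie in $[0,1]$). **Interaction.** Let $P_1$ be a probability distribution on $\mathcal S\times\Theta$ (for instance a product of a prior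 on states and a prior on models), and draw the true state and model $(S_*,\theta_*)\sim P_1$. In round $t=1,\dots,n$ a context $X_t$ is generated by an arbitrary process, i.e. from an arbitrary conditional distribution given the history $H_t=(X_1,A_1,R_1,\dots,X_{t-1},A_{t-1},R_{t-1})$; the agent chooses $A_t\in\mathcal A$; and the reward $R_t\sim P(\cdot\mid A_t,X_t,S_*,\theta_*)$ is observed. The algorithm mmTS samples $(B_t,\hat\theta_t)$ from the joint posterior, that is, from the conditional distribution of $(S_*,\theta_*)$ given $H_t$ (independently of $X_t$ and of $(S_*,\theta_*)$ given $H_t$), and plays $A_t=\arg\max_{a\in\mathcal A}\mu(a,X_t,B_t,\hat\theta_t)$, where ties in $\arg\max_a\mu(a,x,s,\theta)$ are broken by a fixed, arbitrary measurable rule. Its $n$-round Bayes regret is $$\mathcal{BR}(n)=\mathbb E\Big[\sum_{t=1}^n\mu(A_{t,*},X_t,S_*,\theta_*)-\mu(A_t,X_t,S_*,\theta_*)\Big],\qquad A_{t,*}=\arg\max_{a\in\mathcal A}\mu(a,X_t,S_*,\theta_*).$$ **Statement.** Let $\bar\mu(a,x,s)=\int\mu(a,x,s,\theta)\,P_1(d\theta)$,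 where $P_1(d\theta)$ is the $\theta$-marginal of $P_1$, and let $\varepsilon,\delta>0$ be such that, for $\theta_*\sim P_1$, $$\mathbb P\big(\forall a\in\mathcal A,\,x\in\mathcal X,\,s\in\mathcal S:\ |\bar\mu(a,x,s)-\mu(a,x,s,\theta_*)|\le\varepsilon\big)\ \ge\ 1-\delta .$$ Then for every $n$ the $n$-round regret of mmTS is integrable and $$\mathcal{BR}(n)\ \le\ n\delta+3|\mathcal S|+2n\varepsilon+2\sigma\sqrt{6|\mathcal S|\,n\log n}.$$ -/

import Mathlib

open MeasureTheory ProbabilityTheory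
open scoped NNReal

namespace LatentBandit

/-- What the agent has observed before round `t` (rounds are numbered from `0`): the contexts,
the actions it took and the rewards it received, `(X_0, A_0, R_0), …, (X_{t-1}, A_{t-1}, R_{t-1})`. -/
abbrev History (K : ℕ) (X : Type*) (t : ℕ) : Type _ := Fin t → X × Fin K × ℝ

/-- Appends the observation of round `t` to the history. -/
def History.extend {K : ℕ} {X : Type*} {t : ℕ} (h : History K X t) (o : X × Fin K × ℝ) :
    History K X (t + 1) :=
  Fin.snoc (α := fun _ => X × Fin K × ℝ) h o

theorem History.measurable_extend {K : ℕ} {X : Type*} [MeasurableSpace X] {t : ℕ} :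
    Measurable (fun p : History K X t × (X × Fin K × ℝ) => p.1.extend p.2) := by
  refine measurable_pi_lambda _ fun i => ?_
  refine Fin.lastCases ?_ (fun j => ?_) i
  · simpa [History.extend] using measurable_snd
  · simp only [History.extend, Fin.snoc_castSucc]
    exact (measurable_pi_apply j).comp measurable_fst

variable {K : ℕ} {X S Θ : Type*} [MeasurableSpace X] [MeasurableSpace S] [MeasurableSpace Θ]

/-- The mean reward `μ(a, x, s, θ)` of the conditional reward distribution `P(· | a, x, s, θ)`. -/
noncomputable def meanReward (P : Kernel (Fin K × X × S × Θ) ℝ)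
    (a : Fin K) (x : X) (s : S) (θ : Θ) : ℝ :=
  ∫ r, r ∂(P (a, x, s, θ))

/-- The mean reward marginalized over the prior of the model parameter,
`∫ μ(a, x, s, θ) dP₁(θ)`, where `P₁(dθ)` is the `θ`-marginal of the joint prior. -/
noncomputable def marginalMean (P : Kernel (Fin K × X × S × Θ) ℝ) (prior : Measure (S × Θ))
    (a : Fin K) (x : X) (s : S) : ℝ :=
  ∫ θ, meanReward P a x s θ ∂prior.snd

/-- `act x s θ` is an optimal action `argmax_a μ(a, x, s, θ)` (the ties being broken by `act`). -/
def IsArgmax (P : Kernel (Fin K × X × S × Θ) ℝ) (act : X → S → Θ → Fin K) : Prop :=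
  ∀ x s θ a, meanReward P a x s θ ≤ meanReward P (act x s θ) x s θ

/-- The law of the choice `(X_t, A_t)` in one round given the history: the context is drawn from
`ctx`, a state and a model `(B_t, θ̂_t)` are drawn from `post`, independently of the context, and
the action is the one that is optimal for the sampled state and model. -/
noncomputable def choiceKernel {t : ℕ} (ctx : Kernel (History K X t) X)
    (post : Kernel (History K X t) (S × Θ)) (act : X → S → Θ → Fin K) :
    Kernel (History K X t) (X × Fin K) :=
  (ctx ×ₖ post).map fun p => (p.1, act p.1 p.2.1 p.2.2)

/-- The law of the observation `(X_t, A_t, R_t)` of one round given the true state and model and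
the history: the choice depends on the history only, and the reward is then drawn from
`P(· | A_t, X_t, S_*, θ_*)`. -/
noncomputable def roundKernel {t : ℕ} (P : Kernel (Fin K × X × S × Θ) ℝ)
    (choice : Kernel (History K X t) (X × Fin K)) :
    Kernel ((S × Θ) × History K X t) (X × Fin K × ℝ) :=
  ((choice.comap Prod.snd measurable_snd) ⊗ₖ
    (P.comap (fun p : ((S × Θ) × History K X t) × (X × Fin K) =>
      (p.2.2, p.2.1, p.1.1.1, p.1.1.2)) (by fun_prop))).map
    fun q => (q.1.1, q.1.2, q.2)

theorem isMarkovKernel_roundKernel {t : ℕ} (P : Kernel (Fin K × X × S × Θ) ℝ) [IsMarkovKernel P]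
    (ctx : Kernel (History K X t) X) [IsMarkovKernel ctx]
    (post : Kernel (History K X t) (S × Θ)) [IsMarkovKernel post]
    (act : X → S → Θ → Fin K) (hact : Measurable fun p : X × S × Θ => act p.1 p.2.1 p.2.2) :
    IsMarkovKernel (roundKernel P (choiceKernel ctx post act)) := by
  have h1 : IsMarkovKernel (choiceKernel ctx post act) :=
    Kernel.IsMarkovKernel.map _ (measurable_fst.prodMk hact)
  exact Kernel.IsMarkovKernel.map _ (by fun_prop)

section Interaction

variable [StandardBorelSpace S] [StandardBorelSpace Θ] [Nonempty S] [Nonempty Θ]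

/-- The joint posterior: the conditional distribution of `(S_*, θ_*)` given the history, under a
joint law of `(S_*, θ_*)` and the history. -/
noncomputable def posterior {t : ℕ} (law : ProbabilityMeasure ((S × Θ) × History K X t)) :
    Kernel (History K X t) (S × Θ) :=
  condDistrib Prod.fst Prod.snd (law : Measure ((S × Θ) × History K X t))

/-- The joint law of the true state and model `(S_*, θ_*)` and of the history of the first `t`
rounds when the agent runs `mmTS`. The pair `(S_*, θ_*)` is drawn from the prior. In each round
the context is drawn given the history, `(B_t, θ̂_t)` is drawn from the posterior of `(S_*, θ_*)`
given the history, the action maximizes the mean reward under `(B_t, θ̂_t)`, and the reward is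
drawn from `P(· | A_t, X_t, S_*, θ_*)`. -/
noncomputable def mmTSLaw (P : Kernel (Fin K × X × S × Θ) ℝ) [IsMarkovKernel P]
    (prior : Measure (S × Θ)) [IsProbabilityMeasure prior]
    (ctx : ∀ t, Kernel (History K X t) X) [∀ t, IsMarkovKernel (ctx t)]
    (act : X → S → Θ → Fin K) (hact : Measurable fun p : X × S × Θ => act p.1 p.2.1 p.2.2) :
    ∀ t, ProbabilityMeasure ((S × Θ) × History K X t)
  | 0 => ⟨prior.map fun w => (w, fun i => i.elim0),
      Measure.isProbabilityMeasure_map (by fun_prop)⟩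
  | t + 1 =>
    let law := mmTSLaw P prior ctx act hact t
    ⟨((law : Measure ((S × Θ) × History K X t)) ⊗ₘ
        roundKernel P (choiceKernel (ctx t) (posterior law) act)).map
        fun p => (p.1.1, p.1.2.extend p.2), by
      have : IsMarkovKernel (posterior law) := by unfold posterior; infer_instance
      have := isMarkovKernel_roundKernel P (ctx t) (posterior law) act hact
      refine Measure.isProbabilityMeasure_map (Measurable.aemeasurable ?_)
      exact (measurable_fst.comp measurable_fst).prodMk (History.measurable_extend.comp
        ((measurable_snd.comp measurable_fst).prodMk measurable_snd))⟩

end Interaction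

/-- The realized `n`-round regret
`∑_t (μ(A_{t,*}, X_t, S_*, θ_*) - μ(A_t, X_t, S_*, θ_*))` with `A_{t,*} = act X_t S_* θ_*`,
as a function of `(S_*, θ_*)` and the history of `n` rounds. -/
noncomputable def regret (P : Kernel (Fin K × X × S × Θ) ℝ) (act : X → S → Θ → Fin K) (n : ℕ)
    (ω : (S × Θ) × History K X n) : ℝ :=
  ∑ t : Fin n,
    (meanReward P (act (ω.2 t).1 ω.1.1 ω.1.2) (ω.2 t).1 ω.1.1 ω.1.2 -
      meanReward P (ω.2 t).2.1 (ω.2 t).1 ω.1.1 ω.1.2)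

/-- The `n`-round Bayes regret of `mmTS`. -/
noncomputable def bayesRegret [StandardBorelSpace S] [StandardBorelSpace Θ]
    [Nonempty S] [Nonempty Θ]
    (P : Kernel (Fin K × X × S × Θ) ℝ) [IsMarkovKernel P]
    (prior : Measure (S × Θ)) [IsProbabilityMeasure prior]
    (ctx : ∀ t, Kernel (History K X t) X) [∀ t, IsMarkovKernel (ctx t)]
    (act : X → S → Θ → Fin K) (hact : Measurable fun p : X × S × Θ => act p.1 p.2.1 p.2.2)
    (n : ℕ) : ℝ :=
  ∫ ω, regret P act n ω ∂(mmTSLaw P prior ctx act hact n : Measure ((S × Θ) × History K X n))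

end LatentBandit

namespace LatentBandit

/-! Given the history and the context, the truth and the posterior sample are independent draws from
the same law, hence exchangeable (`map_exchange_sampleLaw`). The optimal value under the truth and
the optimal value under the sample therefore agree on average, and the expected regret of a round
equals the expected overestimation `μ(A, X, B, θ̂) - μ(A, X, S, θ)`
(`integral_regret_eq_integral_overestimate`). If the sampled model lies in a set `G` of models that
the marginal mean `m` predicts within `ε`, this is at most `ε + m_B - μ(A, X, S, θ)`; the sampled
model misses `G` with probability at most `δ`, because it has the law of the true one.

It remains to sum `m_B - μ` over the rounds, state by state. The sampled state is not part of the
history, so the indicator of `B = s` is replaced by its conditional probability given history,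
context and action. This gives a predictable weight with the same expectation
(`integral_indicator_sampleLaw`), and these weights sum to at most `1` over the states. For each
state, the score, the weighted sum of prediction minus reward, is observable, and the weight is
switched off as soon as the score exceeds `(ε + lσ²/2) * count + L / l`.

The two regimes are controlled by the same exponential supermartingale, used with opposite signs of
`l`. While the weight is on, the sum of `m_s - μ` is score plus noise: the threshold bounds the
score, and `noise_le` bounds the noise, with an overshoot of at most `1` in the last active round
(`excess_confidenceWeight_le`). If the weight of the sampled state is off, exchange turns this into
the event that the score of the true state is too large although its predictions are accurate. That
forces very negative noise (`one_le_expNoise_neg`) and costs `exp (-L)` per state and round. The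
threshold is linear in the count for one fixed `l`, so no union over possible counts is needed.
Taking `L = log n` and then balancing `l` gives the bound. -/

theorem History.init_extend {K : ℕ} {X : Type*} {t : ℕ} (h : History K X t) (o : X × Fin K × ℝ) :
    Fin.init (α := fun _ => X × Fin K × ℝ) (h.extend o) = h :=
  Fin.init_snoc _ _

theorem History.extend_last {K : ℕ} {X : Type*} {t : ℕ} (h : History K X t) (o : X × Fin K × ℝ) :
    h.extend o (Fin.last t) = o :=
  Fin.snoc_last _ _

/-! ### Measurability of histories and mean rewards. -/

section Measurability

variable {K : ℕ} {X S Θ : Type*} [MeasurableSpace X] [MeasurableSpace S] [MeasurableSpace Θ]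

theorem History.measurable_init {t : ℕ} :
    Measurable fun h : History K X (t + 1) => (Fin.init h : History K X t) :=
  measurable_pi_lambda _ fun i => measurable_pi_apply i.castSucc

theorem measurable_meanReward (P : Kernel (Fin K × X × S × Θ) ℝ) [IsMarkovKernel P] :
    Measurable fun p : Fin K × X × S × Θ => meanReward P p.1 p.2.1 p.2.2.1 p.2.2.2 :=
  (StronglyMeasurable.integral_kernel (κ := P) (f := fun r : ℝ => r)
    measurable_id.stronglyMeasurable).measurable

theorem measurable_marginalMean (P : Kernel (Fin K × X × S × Θ) ℝ) [IsMarkovKernel P]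
    (prior : Measure (S × Θ)) [IsProbabilityMeasure prior] :
    Measurable fun p : Fin K × X × S => marginalMean P prior p.1 p.2.1 p.2.2 := by
  have h : StronglyMeasurable fun q : (Fin K × X × S) × Θ =>
      meanReward P q.1.1 q.1.2.1 q.1.2.2 q.2 :=
    ((measurable_meanReward P).comp (by fun_prop :
      Measurable fun q : (Fin K × X × S) × Θ =>
        (q.1.1, q.1.2.1, q.1.2.2, q.2))).stronglyMeasurable
  exact h.integral_prod_right'.measurable

end Measurability

/-! ### One round of interaction and the exchangeability of truth and sample. -/

section Law

variable {K : ℕ} {X S Θ : Type*} [MeasurableSpace X] [MeasurableSpace S] [MeasurableSpace Θ]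
  [StandardBorelSpace S] [StandardBorelSpace Θ] [Nonempty S] [Nonempty Θ]

instance {t : ℕ} (law : ProbabilityMeasure ((S × Θ) × History K X t)) :
    IsMarkovKernel (posterior law) := by
  unfold posterior; infer_instance

/-- The joint law of the true state and model, the history, and the context and the posterior
sample of the current round. -/
noncomputable def sampleLaw {t : ℕ} (law : ProbabilityMeasure ((S × Θ) × History K X t))
    (ctx : Kernel (History K X t) X) : Measure (((S × Θ) × History K X t) × (X × (S × Θ))) :=
  (law : Measure ((S × Θ) × History K X t)) ⊗ₘ
    ((ctx ×ₖ posterior law).comap Prod.snd measurable_snd)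

instance {t : ℕ} (law : ProbabilityMeasure ((S × Θ) × History K X t))
    (ctx : Kernel (History K X t) X) [IsMarkovKernel ctx] :
    IsProbabilityMeasure (sampleLaw law ctx) := by
  unfold sampleLaw; infer_instance

theorem map_fst_sampleLaw {t : ℕ} (law : ProbabilityMeasure ((S × Θ) × History K X t))
    (ctx : Kernel (History K X t) X) [IsMarkovKernel ctx] :
    (sampleLaw law ctx).map Prod.fst = (law : Measure ((S × Θ) × History K X t)) :=
  Measure.fst_compProd _ _

theorem lintegral_sampleLaw {t : ℕ} (law : ProbabilityMeasure ((S × Θ) × History K X t))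
    (ctx : Kernel (History K X t) X) [IsMarkovKernel ctx]
    {f : ((S × Θ) × History K X t) × (X × (S × Θ)) → ENNReal} (hf : Measurable f) :
    ∫⁻ q, f q ∂sampleLaw law ctx =
      ∫⁻ p, ∫⁻ x, ∫⁻ w, f (p, (x, w)) ∂posterior law p.2 ∂ctx p.2
        ∂(law : Measure ((S × Θ) × History K X t)) := by
  rw [sampleLaw, Measure.lintegral_compProd hf]
  refine lintegral_congr fun p => ?_
  rw [Kernel.comap_apply, Kernel.lintegral_prod _ _ _ (by fun_prop)]

/-- Disintegration along the history. This is the only place where the posterior enters as a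
conditional distribution; elsewhere it is just a kernel. -/
theorem lintegral_law_eq_posterior {t : ℕ} (law : ProbabilityMeasure ((S × Θ) × History K X t))
    {f : (S × Θ) × History K X t → ENNReal} (hf : Measurable f) :
    ∫⁻ p, f p ∂(law : Measure ((S × Θ) × History K X t)) =
      ∫⁻ h, ∫⁻ w, f (w, h) ∂posterior law h
        ∂((law : Measure ((S × Θ) × History K X t)).map Prod.snd) := by
  have h := compProd_map_condDistrib (mβ := MeasurableSpace.pi)
    (X := (Prod.snd : (S × Θ) × History K X t → History K X t)) (Y := Prod.fst)
    (μ := (law : Measure ((S × Θ) × History K X t))) (by fun_prop)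
  rw [← Measure.lintegral_compProd (f := fun q => f (q.2, q.1)) (by fun_prop)]
  unfold posterior
  rw [h, lintegral_map (by fun_prop) (by fun_prop)]

/-- The true state and model and the posterior sample are exchangeable given the history and the
context. -/
theorem map_exchange_sampleLaw {t : ℕ} (law : ProbabilityMeasure ((S × Θ) × History K X t))
    (ctx : Kernel (History K X t) X) [IsMarkovKernel ctx] :
    (sampleLaw law ctx).map (fun q => ((q.2.2, q.1.2), (q.2.1, q.1.1))) = sampleLaw law ctx := by
  refine Measure.ext_of_lintegral _ fun f hf => ?_
  rw [lintegral_map hf (by fun_prop), lintegral_sampleLaw _ _ (by fun_prop),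
    lintegral_sampleLaw _ _ hf]
  -- Once the truth is disintegrated, truth and sample are two independent draws from the posterior
  -- at `h`, and the context depends on `h` alone. The exchange is then Tonelli for the two draws.
  have key : ∀ g : ((S × Θ) × History K X t) × (X × (S × Θ)) → ENNReal, Measurable g →
      ∫⁻ p, ∫⁻ x, ∫⁻ w, g (p, (x, w)) ∂posterior law p.2 ∂ctx p.2
        ∂(law : Measure ((S × Θ) × History K X t)) =
      ∫⁻ h, ∫⁻ x, ∫⁻ w, ∫⁻ w', g ((w, h), (x, w')) ∂posterior law h ∂posterior law h ∂ctx h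
        ∂((law : Measure ((S × Θ) × History K X t)).map Prod.snd) := by
    intro g hg
    let κ : Kernel ((S × Θ) × History K X t) (X × (S × Θ)) :=
      (ctx ×ₖ posterior law).comap Prod.snd measurable_snd
    have hm : Measurable fun p : ((S × Θ) × History K X t) =>
        ∫⁻ x, ∫⁻ w, g (p, (x, w)) ∂posterior law p.2 ∂ctx p.2 := by
      have : (fun p : ((S × Θ) × History K X t) =>
        ∫⁻ x, ∫⁻ w, g (p, (x, w)) ∂posterior law p.2 ∂ctx p.2) = fun p => ∫⁻ y, g (p, y)
          ∂κ p := by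
        ext p
        rw [Kernel.comap_apply, Kernel.lintegral_prod _ _ _ (by fun_prop)]
      rw [this]
      exact hg.lintegral_kernel_prod_right'
    rw [lintegral_law_eq_posterior law hm]
    refine lintegral_congr fun h => ?_
    have hm2 : Measurable fun z : (S × Θ) × X => ∫⁻ w', g ((z.1, h), (z.2, w')) ∂posterior law h :=
      Measurable.lintegral_prod_right' (f := fun y : ((S × Θ) × X) × (S × Θ) =>
        g ((y.1.1, h), (y.1.2, y.2))) (by fun_prop)
    exact lintegral_lintegral_swap (μ := posterior law h) (ν := ctx h)
      (f := fun w x => ∫⁻ w', g ((w, h), (x, w')) ∂posterior law h)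
      hm2.aemeasurable
  rw [key f hf, key (fun q => f ((q.2.2, q.1.2), (q.2.1, q.1.1))) (by fun_prop)]
  refine lintegral_congr fun h => lintegral_congr fun x => ?_
  exact lintegral_lintegral_swap (f := fun w w' => f ((w', h), (x, w)))
    (by fun_prop)

variable (P : Kernel (Fin K × X × S × Θ) ℝ) [IsMarkovKernel P]
    (prior : Measure (S × Θ)) [IsProbabilityMeasure prior]
    (ctx : ∀ t, Kernel (History K X t) X) [∀ t, IsMarkovKernel (ctx t)]
    (act : X → S → Θ → Fin K) (hact : Measurable fun p : X × S × Θ => act p.1 p.2.1 p.2.2)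

/-- The history forgets the posterior sample and keeps only the action. Writing the round through
`sampleLaw` retains the sample, so that exchangeability can be applied. -/
theorem lintegral_mmTSLaw_succ (t : ℕ) {f : (S × Θ) × History K X (t + 1) → ENNReal}
    (hf : Measurable f) :
    ∫⁻ p, f p ∂(mmTSLaw P prior ctx act hact (t + 1) : Measure _) =
      ∫⁻ q, ∫⁻ r, f (q.1.1, q.1.2.extend (q.2.1, act q.2.1 q.2.2.1 q.2.2.2, r))
          ∂P (act q.2.1 q.2.2.1 q.2.2.2, q.2.1, q.1.1.1, q.1.1.2)
        ∂sampleLaw (mmTSLaw P prior ctx act hact t) (ctx t) := by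
  set law := mmTSLaw P prior ctx act hact t with hlaw
  have hE : Measurable fun p : ((S × Θ) × History K X t) × (X × Fin K × ℝ) =>
      (p.1.1, p.1.2.extend p.2) :=
    (measurable_fst.comp measurable_fst).prodMk (History.measurable_extend.comp
        ((measurable_snd.comp measurable_fst).prodMk measurable_snd))
  have hfE : Measurable fun p : ((S × Θ) × History K X t) × (X × Fin K × ℝ) =>
      f (p.1.1, p.1.2.extend p.2) := hf.comp hE
  have := isMarkovKernel_roundKernel P (ctx t) (posterior law) act hact
  have hc : IsMarkovKernel (choiceKernel (ctx t) (posterior law) act) :=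
    Kernel.IsMarkovKernel.map _ (measurable_fst.prodMk hact)
  have hL : (mmTSLaw P prior ctx act hact (t + 1) : Measure ((S × Θ) × History K X (t + 1))) =
      ((law : Measure ((S × Θ) × History K X t)) ⊗ₘ
        roundKernel P (choiceKernel (ctx t) (posterior law) act)).map
        fun p => (p.1.1, p.1.2.extend p.2) := rfl
  rw [hL, lintegral_map hf hE, Measure.lintegral_compProd hfE, sampleLaw,
    Measure.lintegral_compProd]
  · refine lintegral_congr fun p => ?_
    have hg : Measurable fun o : X × Fin K × ℝ => f (p.1, p.2.extend o) :=
      hfE.comp (measurable_const.prodMk measurable_id)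
    have hg' : Measurable fun q : (X × Fin K) × ℝ => f (p.1, p.2.extend (q.1.1, q.1.2, q.2)) :=
      hg.comp (by fun_prop)
    rw [roundKernel, Kernel.lintegral_map _ (by fun_prop) _ hg,
      Kernel.lintegral_compProd _ _ _ hg', Kernel.comap_apply, Kernel.comap_apply,
      choiceKernel, Kernel.lintegral_map _ (measurable_fst.prodMk hact)]
    · rfl
    · exact Measurable.lintegral_kernel_prod_right' (f := fun z : (X × Fin K) × ℝ =>
        f (p.1, p.2.extend (z.1.1, z.1.2, z.2))) (κ := P.comap
          (fun y : X × Fin K => (y.2, y.1, p.1.1, p.1.2)) (by fun_prop)) hg'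
  · have hp : Measurable fun q : ((S × Θ) × History K X t) × (X × (S × Θ)) =>
        (act q.2.1 q.2.2.1 q.2.2.2, q.2.1, q.1.1.1, q.1.1.2) :=
      (hact.comp measurable_snd).prodMk (by fun_prop)
    have hz : Measurable fun z : (((S × Θ) × History K X t) × (X × (S × Θ))) × ℝ =>
        (z.1.1, (z.1.2.1, act z.1.2.1 z.1.2.2.1 z.1.2.2.2, z.2)) := by
      refine Measurable.prodMk (by fun_prop) (Measurable.prodMk (by fun_prop)
        (Measurable.prodMk ?_ (by fun_prop)))
      exact hact.comp (measurable_snd.comp measurable_fst)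
    exact Measurable.lintegral_kernel_prod_right' (κ := P.comap _ hp) (hfE.comp hz)

/-- For statistics that do not see the newest reward, the inner integral is over a probability
measure of a constant and disappears. -/
theorem map_mmTSLaw_succ (t : ℕ) {β : Type*} [MeasurableSpace β]
    {F : (S × Θ) × History K X (t + 1) → β} (hF : Measurable F)
    {G : ((S × Θ) × History K X t) × (X × (S × Θ)) → β} (hG : Measurable G)
    (hFG : ∀ w h x w' r, F (w, History.extend h (x, act x w'.1 w'.2, r)) = G ((w, h), (x, w'))) :
    (mmTSLaw P prior ctx act hact (t + 1) : Measure _).map F =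
      (sampleLaw (mmTSLaw P prior ctx act hact t) (ctx t)).map G := by
  refine Measure.ext_of_lintegral _ fun f hf => ?_
  rw [lintegral_map hf hF, lintegral_map hf hG, lintegral_mmTSLaw_succ P prior ctx act hact t
    (f := fun p => f (F p)) (hf.comp hF)]
  refine lintegral_congr fun q => ?_
  simp only [hFG, lintegral_const, measure_univ, mul_one, Prod.mk.eta]

theorem integral_mmTSLaw_succ (t : ℕ)
    {F : (S × Θ) × History K X (t + 1) → ℝ} (hF : Measurable F)
    {G : ((S × Θ) × History K X t) × (X × (S × Θ)) → ℝ} (hG : Measurable G)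
    (hFG : ∀ w h x w' r, F (w, History.extend h (x, act x w'.1 w'.2, r)) = G ((w, h), (x, w'))) :
    ∫ p, F p ∂(mmTSLaw P prior ctx act hact (t + 1) : Measure _) =
      ∫ q, G q ∂sampleLaw (mmTSLaw P prior ctx act hact t) (ctx t) := by
  have h := map_mmTSLaw_succ P prior ctx act hact t hF hG hFG
  have h1 := integral_map (μ := (mmTSLaw P prior ctx act hact (t + 1) : Measure _))
    hF.aemeasurable (f := fun y : ℝ => y) measurable_id.aestronglyMeasurable
  have h2 := integral_map (μ := sampleLaw (mmTSLaw P prior ctx act hact t) (ctx t))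
    hG.aemeasurable (f := fun y : ℝ => y) measurable_id.aestronglyMeasurable
  rw [← h1, ← h2, h]

theorem integral_fst_sampleLaw {t : ℕ} (law : ProbabilityMeasure ((S × Θ) × History K X t))
    (ctx : Kernel (History K X t) X) [IsMarkovKernel ctx]
    {f : (S × Θ) × History K X t → ℝ} (hf : Measurable f) :
    ∫ q, f q.1 ∂sampleLaw law ctx = ∫ p, f p ∂(law : Measure _) := by
  rw [← map_fst_sampleLaw law ctx]
  exact (integral_map measurable_fst.aemeasurable hf.aestronglyMeasurable).symm

end Law

/-! ### Sums over the rounds of a history. -/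

section Cumulative

variable {K : ℕ} {X : Type*}

/-- The sum over the rounds of a function of the past and of the observation of the round. -/
def cumulative (f : ∀ t, History K X t → X × Fin K × ℝ → ℝ) : ∀ t, History K X t → ℝ
  | 0, _ => 0
  | t + 1, h => cumulative f t (Fin.init h) + f t (Fin.init h) (h (Fin.last t))

theorem cumulative_extend (f : ∀ t, History K X t → X × Fin K × ℝ → ℝ) {t : ℕ}
    (h : History K X t) (o : X × Fin K × ℝ) :
    cumulative f (t + 1) (h.extend o) = cumulative f t h + f t h o := by
  rw [cumulative, History.init_extend, History.extend_last]

theorem cumulative_mono {f g : ∀ t, History K X t → X × Fin K × ℝ → ℝ}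
    (hfg : ∀ t h o, f t h o ≤ g t h o) : ∀ t h, cumulative f t h ≤ cumulative g t h
  | 0, _ => le_rfl
  | t + 1, _ => add_le_add (cumulative_mono hfg t _) (hfg _ _ _)

theorem cumulative_add (f g : ∀ t, History K X t → X × Fin K × ℝ → ℝ) :
    ∀ t h, cumulative (fun t h o => f t h o + g t h o) t h = cumulative f t h + cumulative g t h
  | 0, _ => (add_zero _).symm
  | t + 1, h => by simp only [cumulative, cumulative_add f g t]; ring

theorem cumulative_const_mul (c : ℝ) (f : ∀ t, History K X t → X × Fin K × ℝ → ℝ) :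
    ∀ t h, cumulative (fun t h o => c * f t h o) t h = c * cumulative f t h
  | 0, _ => (mul_zero _).symm
  | t + 1, h => by simp only [cumulative, cumulative_const_mul c f t]; ring

theorem cumulative_const (c : ℝ) :
    ∀ t (h : History K X t), cumulative (fun _ _ _ => c) t h = t * c
  | 0, _ => by simp [cumulative]
  | t + 1, h => by simp only [cumulative, cumulative_const c t]; push_cast; ring

theorem cumulative_sum {ι : Type*} (s : Finset ι)
    (f : ι → ∀ t, History K X t → X × Fin K × ℝ → ℝ) :
    ∀ t h, cumulative (fun t h o => ∑ i ∈ s, f i t h o) t h = ∑ i ∈ s, cumulative (f i) t h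
  | 0, _ => Finset.sum_const_zero.symm
  | t + 1, h => by simp only [cumulative, cumulative_sum s f t, Finset.sum_add_distrib]

theorem abs_cumulative_le {f : ∀ t, History K X t → X × Fin K × ℝ → ℝ}
    (hf : ∀ t h o, |f t h o| ≤ 1) : ∀ t h, |cumulative f t h| ≤ t
  | 0, _ => by simp [cumulative]
  | t + 1, h => by
    rw [cumulative]
    push_cast
    exact (abs_add_le _ _).trans (add_le_add (abs_cumulative_le hf t _) (hf _ _ _))

theorem measurable_cumulative [MeasurableSpace X] {W : Type*} [MeasurableSpace W]
    {f : W → ∀ t, History K X t → X × Fin K × ℝ → ℝ}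
    (hf : ∀ t, Measurable fun p : W × History K X t × (X × Fin K × ℝ) => f p.1 t p.2.1 p.2.2) :
    ∀ t, Measurable fun p : W × History K X t => cumulative (f p.1) t p.2
  | 0 => by simpa only [cumulative] using measurable_const
  | t + 1 => by
    simp only [cumulative]
    have hi : Measurable fun p : W × History K X (t + 1) => (Fin.init p.2 : History K X t) :=
      History.measurable_init.comp measurable_snd
    exact ((measurable_cumulative hf t).comp (measurable_fst.prodMk hi)).add
      ((hf t).comp (measurable_fst.prodMk (hi.prodMk
        ((measurable_pi_apply (Fin.last t)).comp measurable_snd))))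

end Cumulative

/-! ### Predictable weights and the exponential supermartingale. -/

section Weights

variable {K : ℕ} {X S Θ : Type*} [MeasurableSpace X] [MeasurableSpace S] [MeasurableSpace Θ]

/-- A predictable weight with values in `[0, 1]`. -/
structure IsWeight (v : ∀ t, History K X t → X → Fin K → ℝ) : Prop where
  measurable : ∀ t, Measurable fun p : History K X t × X × Fin K => v t p.1 p.2.1 p.2.2
  nonneg : ∀ t h x a, 0 ≤ v t h x a
  le_one : ∀ t h x a, v t h x a ≤ 1

/-- The total weight of the rounds. -/
def count (v : ∀ t, History K X t → X → Fin K → ℝ) : ∀ t, History K X t → ℝ :=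
  cumulative fun t h o => v t h o.1 o.2.1

/-- The weighted sum of the differences between the predicted and the observed rewards. -/
def score (v : ∀ t, History K X t → X → Fin K → ℝ) (m : Fin K → X → ℝ) :
    ∀ t, History K X t → ℝ :=
  cumulative fun t h o => v t h o.1 o.2.1 * (m o.2.1 o.1 - o.2.2)

/-- The weighted sum of the deviations of the rewards from their means. -/
noncomputable def noise (P : Kernel (Fin K × X × S × Θ) ℝ)
    (v : ∀ t, History K X t → X → Fin K → ℝ) (w : S × Θ) : ∀ t, History K X t → ℝ :=
  cumulative fun t h o => v t h o.1 o.2.1 * (o.2.2 - meanReward P o.2.1 o.1 w.1 w.2)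

/-- The weighted sum of the differences between the predicted and the true mean rewards. -/
noncomputable def excess (P : Kernel (Fin K × X × S × Θ) ℝ)
    (v : ∀ t, History K X t → X → Fin K → ℝ) (m : Fin K → X → ℝ) (w : S × Θ) :
    ∀ t, History K X t → ℝ :=
  cumulative fun t h o => v t h o.1 o.2.1 * (m o.2.1 o.1 - meanReward P o.2.1 o.1 w.1 w.2)

/-- The exponential supermartingale of the weighted noise. -/
noncomputable def expNoise (P : Kernel (Fin K × X × S × Θ) ℝ)
    (v : ∀ t, History K X t → X → Fin K → ℝ) (σ l : ℝ) (w : S × Θ) (t : ℕ)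
    (h : History K X t) : ℝ :=
  Real.exp (l * noise P v w t h - l ^ 2 * σ ^ 2 / 2 * count v t h)

/-- The observed rewards cancel round by round. This splits the unobservable excess into an
observable score and a martingale part. -/
theorem score_add_noise (P : Kernel (Fin K × X × S × Θ) ℝ)
    (v : ∀ t, History K X t → X → Fin K → ℝ) (m : Fin K → X → ℝ) (w : S × Θ) (t : ℕ)
    (h : History K X t) : score v m t h + noise P v w t h = excess P v m w t h := by
  rw [score, noise, excess, ← cumulative_add]
  congr 1
  funext t h o
  ring

variable {v : ∀ t, History K X t → X → Fin K → ℝ}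

theorem IsWeight.measurable_obs (hv : IsWeight v) {W : Type*} [MeasurableSpace W] (t : ℕ) :
    Measurable fun p : W × History K X t × (X × Fin K × ℝ) => v t p.2.1 p.2.2.1 p.2.2.2.1 :=
  (hv.measurable t).comp (by fun_prop :
    Measurable fun p : W × History K X t × (X × Fin K × ℝ) => (p.2.1, p.2.2.1, p.2.2.2.1))

theorem measurable_meanReward_obs (P : Kernel (Fin K × X × S × Θ) ℝ) [IsMarkovKernel P] (t : ℕ) :
    Measurable fun p : (S × Θ) × History K X t × (X × Fin K × ℝ) =>
      meanReward P p.2.2.2.1 p.2.2.1 p.1.1 p.1.2 :=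
  (measurable_meanReward P).comp (by fun_prop :
    Measurable fun p : (S × Θ) × History K X t × (X × Fin K × ℝ) =>
      (p.2.2.2.1, p.2.2.1, p.1.1, p.1.2))

theorem IsWeight.measurable_count (hv : IsWeight v) (t : ℕ) : Measurable (count v t) :=
  (measurable_cumulative (W := Unit) (f := fun _ t h o => v t h o.1 o.2.1)
    hv.measurable_obs t).comp (measurable_const (a := ()) |>.prodMk measurable_id)

theorem IsWeight.measurable_noise (hv : IsWeight v) (P : Kernel (Fin K × X × S × Θ) ℝ)
    [IsMarkovKernel P] (t : ℕ) :
    Measurable fun p : (S × Θ) × History K X t => noise P v p.1 t p.2 :=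
  measurable_cumulative (W := S × Θ) (f := fun w t h o =>
      v t h o.1 o.2.1 * (o.2.2 - meanReward P o.2.1 o.1 w.1 w.2))
    (fun t => (hv.measurable_obs t).mul
      ((by fun_prop : Measurable fun p : (S × Θ) × History K X t × (X × Fin K × ℝ) =>
        p.2.2.2.2).sub (measurable_meanReward_obs P t))) t

theorem IsWeight.measurable_expNoise (hv : IsWeight v) (P : Kernel (Fin K × X × S × Θ) ℝ)
    [IsMarkovKernel P] (σ l : ℝ) (t : ℕ) :
    Measurable fun p : (S × Θ) × History K X t => expNoise P v σ l p.1 t p.2 :=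
  (((hv.measurable_noise P t).const_mul _).sub
    (((hv.measurable_count t).comp measurable_snd).const_mul _)).exp

/-- The weight is fixed before the reward is drawn, so the sub-Gaussian bound applies at the
parameter `l * y`. -/
theorem IsWeight.lintegral_expNoise_step (hv : IsWeight v) (P : Kernel (Fin K × X × S × Θ) ℝ)
    {σ : ℝ≥0} (hsubG : ∀ a x s θ,
      HasSubgaussianMGF (fun r => r - meanReward P a x s θ) (σ ^ 2) (P (a, x, s, θ)))
    (l : ℝ) (w : S × Θ) {t : ℕ} (h : History K X t) (x : X) (a : Fin K) :
    ∫⁻ r, ENNReal.ofReal (expNoise P v σ l w (t + 1) (h.extend (x, a, r))) ∂P (a, x, w.1, w.2) ≤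
      ENNReal.ofReal (expNoise P v σ l w t h) := by
  set y := v t h x a with hy
  have h0 : 0 ≤ y := hv.nonneg ..
  have h1 : y ≤ 1 := hv.le_one ..
  have hG := hsubG a x w.1 w.2
  have hsplit : ∀ r, expNoise P v σ l w (t + 1) (h.extend (x, a, r)) =
      expNoise P v σ l w t h * Real.exp (-(l ^ 2 * σ ^ 2 / 2 * y)) *
        Real.exp (l * y * (r - meanReward P a x w.1 w.2)) := by
    intro r
    simp only [expNoise, noise, count, cumulative_extend, ← Real.exp_add, ← hy]
    congr 1
    ring
  simp only [hsplit]
  have hint := hG.integrable_exp_mul (l * y)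
  rw [← ofReal_integral_eq_lintegral_ofReal (hint.const_mul _)
    (Filter.Eventually.of_forall fun r => by unfold expNoise; positivity)]
  refine ENNReal.ofReal_le_ofReal ?_
  rw [integral_const_mul, mul_assoc]
  refine mul_le_of_le_one_right (Real.exp_pos _).le ?_
  calc _ ≤ Real.exp (-(l ^ 2 * σ ^ 2 / 2 * y)) *
        Real.exp (((σ ^ 2 : ℝ≥0) : ℝ) * (l * y) ^ 2 / 2) :=
        mul_le_mul_of_nonneg_left (hG.mgf_le (l * y)) (Real.exp_pos _).le
    _ ≤ 1 := by
      rw [← Real.exp_add, Real.exp_le_one_iff]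
      -- Since `0 ≤ y ≤ 1`, `y² ≤ y`; this is why the compensator may be the count of weights
      -- instead of the sum of their squares.
      have : (l ^ 2 * (σ : ℝ) ^ 2) * (y * y) ≤ (l ^ 2 * (σ : ℝ) ^ 2) * y :=
        mul_le_mul_of_nonneg_left (mul_le_of_le_one_right h0 h1) (by positivity)
      push_cast
      nlinarith

end Weights

/-! ### Expectations along the interaction. -/

section Expectation

variable {K : ℕ} {X S Θ : Type*} [MeasurableSpace X] [MeasurableSpace S] [MeasurableSpace Θ]
  [StandardBorelSpace S] [StandardBorelSpace Θ] [Nonempty S] [Nonempty Θ]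
  (P : Kernel (Fin K × X × S × Θ) ℝ) [IsMarkovKernel P]
  (prior : Measure (S × Θ)) [IsProbabilityMeasure prior]
  (ctx : ∀ t, Kernel (History K X t) X) [∀ t, IsMarkovKernel (ctx t)]
  (act : X → S → Θ → Fin K) (hact : Measurable fun p : X × S × Θ => act p.1 p.2.1 p.2.2)

/-- The one-step bound holds for every truth, context and action, so it survives averaging over the
round whatever rule produces the contexts and actions. -/
theorem IsWeight.lintegral_expNoise_le {v : ∀ t, History K X t → X → Fin K → ℝ} (hv : IsWeight v)
    {σ : ℝ≥0} (hsubG : ∀ a x s θ,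
      HasSubgaussianMGF (fun r => r - meanReward P a x s θ) (σ ^ 2) (P (a, x, s, θ)))
    (l : ℝ) (t : ℕ) :
    ∫⁻ p, ENNReal.ofReal (expNoise P v σ l p.1 t p.2)
      ∂(mmTSLaw P prior ctx act hact t : Measure ((S × Θ) × History K X t)) ≤ 1 := by
  induction t with
  | zero => simp [expNoise, noise, count, cumulative]
  | succ t ih =>
    rw [lintegral_mmTSLaw_succ P prior ctx act hact t (hv.measurable_expNoise P σ l _).ennreal_ofReal]
    refine le_trans (lintegral_mono fun q =>
      hv.lintegral_expNoise_step P hsubG l q.1.1 q.1.2 q.2.1 _) (le_trans (le_of_eq ?_) ih)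
    conv_rhs => rw [← map_fst_sampleLaw (mmTSLaw P prior ctx act hact t) (ctx t)]
    rw [lintegral_map (hv.measurable_expNoise P σ l _).ennreal_ofReal measurable_fst]

theorem IsWeight.integrable_expNoise {v : ∀ t, History K X t → X → Fin K → ℝ} (hv : IsWeight v)
    {σ : ℝ≥0} (hsubG : ∀ a x s θ,
      HasSubgaussianMGF (fun r => r - meanReward P a x s θ) (σ ^ 2) (P (a, x, s, θ)))
    (l : ℝ) (t : ℕ) :
    Integrable (fun p => expNoise P v σ l p.1 t p.2)
      (mmTSLaw P prior ctx act hact t : Measure ((S × Θ) × History K X t)) := by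
  have hpos : ∀ p : (S × Θ) × History K X t, 0 ≤ expNoise P v σ l p.1 t p.2 :=
    fun p => (Real.exp_pos _).le
  refine ⟨(hv.measurable_expNoise P σ l t).aestronglyMeasurable, ?_⟩
  rw [hasFiniteIntegral_iff_ofReal (Filter.Eventually.of_forall hpos)]
  exact (hv.lintegral_expNoise_le P prior ctx act hact hsubG l t).trans_lt ENNReal.one_lt_top

theorem IsWeight.integral_expNoise_le {v : ∀ t, History K X t → X → Fin K → ℝ} (hv : IsWeight v)
    {σ : ℝ≥0} (hsubG : ∀ a x s θ,
      HasSubgaussianMGF (fun r => r - meanReward P a x s θ) (σ ^ 2) (P (a, x, s, θ)))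
    (l : ℝ) (t : ℕ) :
    ∫ p, expNoise P v σ l p.1 t p.2
      ∂(mmTSLaw P prior ctx act hact t : Measure ((S × Θ) × History K X t)) ≤ 1 := by
  have h := hv.lintegral_expNoise_le P prior ctx act hact hsubG l t
  rw [← ofReal_integral_eq_lintegral_ofReal (hv.integrable_expNoise P prior ctx act hact hsubG l t)
    (Filter.Eventually.of_forall fun p => (Real.exp_pos _).le), ENNReal.ofReal_le_one] at h
  exact h

/-- Consistency of the laws in the horizon; it transports integrals of past quantities to the longer
history. -/
theorem map_init_mmTSLaw (t : ℕ) :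
    (mmTSLaw P prior ctx act hact (t + 1) : Measure ((S × Θ) × History K X (t + 1))).map
      (fun p => (p.1, (Fin.init p.2 : History K X t))) =
    (mmTSLaw P prior ctx act hact t : Measure ((S × Θ) × History K X t)) := by
  rw [← map_fst_sampleLaw (mmTSLaw P prior ctx act hact t) (ctx t)]
  refine map_mmTSLaw_succ P prior ctx act hact t
    (measurable_fst.prodMk (History.measurable_init.comp measurable_snd)) measurable_fst ?_
  intro w h x w' r
  exact Prod.ext rfl (History.init_extend _ _)

/-- The cumulative sum of the exponential supermartingale is integrable, of integral at most the
number of rounds. -/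
theorem IsWeight.integral_cumulative_expNoise_le {v : ∀ t, History K X t → X → Fin K → ℝ}
    (hv : IsWeight v)
    {σ : ℝ≥0} (hsubG : ∀ a x s θ,
      HasSubgaussianMGF (fun r => r - meanReward P a x s θ) (σ ^ 2) (P (a, x, s, θ)))
    (l : ℝ) (t : ℕ) :
    Integrable (fun p => cumulative (fun t h _ => expNoise P v σ l p.1 t h) t p.2)
      (mmTSLaw P prior ctx act hact t : Measure ((S × Θ) × History K X t)) ∧
    ∫ p, cumulative (fun t h _ => expNoise P v σ l p.1 t h) t p.2
      ∂(mmTSLaw P prior ctx act hact t : Measure ((S × Θ) × History K X t)) ≤ t := by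
  induction t with
  | zero => simp [cumulative]
  | succ t ih =>
    obtain ⟨ih1, ih2⟩ := ih
    have hZ := hv.integrable_expNoise P prior ctx act hact hsubG l t
    have hZ1 := hv.integral_expNoise_le P prior ctx act hact hsubG l t
    have hm : Measurable fun p : (S × Θ) × History K X (t + 1) =>
        (p.1, (Fin.init p.2 : History K X t)) :=
      measurable_fst.prodMk (History.measurable_init.comp measurable_snd)
    have hsum := ih1.add hZ
    have hsum' := hsum
    rw [← map_init_mmTSLaw P prior ctx act hact t] at hsum'
    have hle := integral_map hm.aemeasurable hsum'.aestronglyMeasurable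
    rw [map_init_mmTSLaw P prior ctx act hact t] at hle
    refine ⟨hsum'.comp_measurable hm, ?_⟩
    refine (le_of_eq hle.symm).trans ?_
    rw [integral_add' ih1 hZ]
    push_cast
    exact add_le_add ih2 hZ1

/-- One more round adds to the expectation of a cumulative sum that does not involve the rewards
the expectation of the new term. -/
theorem integral_cumulative_succ {g : (S × Θ) → ∀ t, History K X t → X → Fin K → ℝ}
    (hg : ∀ t, Measurable fun p : (S × Θ) × History K X t × X × Fin K =>
      g p.1 t p.2.1 p.2.2.1 p.2.2.2)
    (hg1 : ∀ w t h x a, |g w t h x a| ≤ 1) (t : ℕ) :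
    ∫ p, cumulative (fun t h o => g p.1 t h o.1 o.2.1) (t + 1) p.2
      ∂(mmTSLaw P prior ctx act hact (t + 1) : Measure ((S × Θ) × History K X (t + 1))) =
    ∫ p, cumulative (fun t h o => g p.1 t h o.1 o.2.1) t p.2
      ∂(mmTSLaw P prior ctx act hact t : Measure ((S × Θ) × History K X t)) +
    ∫ q, g q.1.1 t q.1.2 q.2.1 (act q.2.1 q.2.2.1 q.2.2.2)
      ∂sampleLaw (mmTSLaw P prior ctx act hact t) (ctx t) := by
  have hM := measurable_cumulative (W := S × Θ) (f := fun w t h o => g w t h o.1 o.2.1)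
    (fun t => (hg t).comp (by fun_prop :
      Measurable fun p : (S × Θ) × History K X t × (X × Fin K × ℝ) =>
        (p.1, p.2.1, p.2.2.1, p.2.2.2.1)))
  have hM2 : Measurable fun q : ((S × Θ) × History K X t) × (X × (S × Θ)) =>
      g q.1.1 t q.1.2 q.2.1 (act q.2.1 q.2.2.1 q.2.2.2) :=
    (hg t).comp (Measurable.prodMk (by fun_prop) (Measurable.prodMk (by fun_prop)
      (Measurable.prodMk (by fun_prop) (hact.comp measurable_snd))))
  rw [integral_mmTSLaw_succ P prior ctx act hact t (hM (t + 1))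
    (G := fun q => cumulative (fun t h o => g q.1.1 t h o.1 o.2.1) t q.1.2 +
      g q.1.1 t q.1.2 q.2.1 (act q.2.1 q.2.2.1 q.2.2.2)) (((hM t).comp measurable_fst).add hM2)
    (fun w h x w' r => cumulative_extend _ _ _), integral_add,
    integral_fst_sampleLaw _ _ (hM t)]
  · exact Integrable.of_bound ((hM t).comp measurable_fst).aestronglyMeasurable t
      (Filter.Eventually.of_forall fun q => abs_cumulative_le (fun t h o => hg1 _ _ _ _ _) _ _)
  · exact Integrable.of_bound hM2.aestronglyMeasurable 1
      (Filter.Eventually.of_forall fun q => hg1 _ _ _ _ _)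

end Expectation

/-! ### Weights stopped when a state is contradicted by the rewards. -/

section Confidence

variable {K : ℕ} {X S Θ : Type*} [MeasurableSpace X] [MeasurableSpace S] [MeasurableSpace Θ]

/-- The count and the score of the weights `u` switched off in the rounds where the score exceeds
`c * count + b`. -/
noncomputable def confidenceStat (u : ∀ t, History K X t → X → Fin K → ℝ) (m : Fin K → X → ℝ)
    (c b : ℝ) : ∀ t, History K X t → ℝ × ℝ
  | 0, _ => (0, 0)
  | t + 1, h =>
    let p := confidenceStat u m c b t (Fin.init h)
    let o := h (Fin.last t)
    let v := if p.2 ≤ c * p.1 + b then u t (Fin.init h) o.1 o.2.1 else 0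
    (p.1 + v, p.2 + v * (m o.2.1 o.1 - o.2.2))

/-- The weights `u` switched off in the rounds where the score exceeds `c * count + b`. -/
noncomputable def confidenceWeight (u : ∀ t, History K X t → X → Fin K → ℝ) (m : Fin K → X → ℝ)
    (c b : ℝ) (t : ℕ) (h : History K X t) (x : X) (a : Fin K) : ℝ :=
  if (confidenceStat u m c b t h).2 ≤ c * (confidenceStat u m c b t h).1 + b then u t h x a else 0

/-- The stopped weight depends on a score that is itself built from earlier stopped weights. The
joint recursion breaks this circle, and here its output is identified with the count and score of
the stopped weight. -/
theorem confidenceStat_eq {K : ℕ} {X : Type*} (u : ∀ t, History K X t → X → Fin K → ℝ)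
    (m : Fin K → X → ℝ) (c b : ℝ) : ∀ t h, confidenceStat u m c b t h =
      (count (confidenceWeight u m c b) t h, score (confidenceWeight u m c b) m t h)
  | 0, _ => rfl
  | t + 1, h => by
    have ih := confidenceStat_eq u m c b t (Fin.init h)
    simp only [confidenceStat, count, score, cumulative, confidenceWeight] at ih ⊢
    rw [ih]

theorem confidenceWeight_of_le {K : ℕ} {X : Type*} {u : ∀ t, History K X t → X → Fin K → ℝ}
    {m : Fin K → X → ℝ} {c b : ℝ} {t : ℕ} {h : History K X t}
    (hle : score (confidenceWeight u m c b) m t h ≤ c * count (confidenceWeight u m c b) t h + b)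
    (x : X) (a : Fin K) : confidenceWeight u m c b t h x a = u t h x a := by
  rw [confidenceWeight, confidenceStat_eq, if_pos hle]

theorem confidenceWeight_of_not_le {K : ℕ} {X : Type*} {u : ∀ t, History K X t → X → Fin K → ℝ}
    {m : Fin K → X → ℝ} {c b : ℝ} {t : ℕ} {h : History K X t}
    (hle : ¬ score (confidenceWeight u m c b) m t h ≤
      c * count (confidenceWeight u m c b) t h + b)
    (x : X) (a : Fin K) : confidenceWeight u m c b t h x a = 0 := by
  rw [confidenceWeight, confidenceStat_eq, if_neg hle]

theorem measurable_confidenceStat {u : ∀ t, History K X t → X → Fin K → ℝ} (hu : IsWeight u)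
    {m : Fin K → X → ℝ} (hm : Measurable fun p : Fin K × X => m p.1 p.2) (c b : ℝ) :
    ∀ t, Measurable (confidenceStat u m c b t)
  | 0 => measurable_const
  | t + 1 => by
    have ih : Measurable fun h : History K X (t + 1) => confidenceStat u m c b t (Fin.init h) :=
      (measurable_confidenceStat hu hm c b t).comp History.measurable_init
    have hl : Measurable fun h : History K X (t + 1) => h (Fin.last t) := measurable_pi_apply _
    have hu' : Measurable fun h : History K X (t + 1) =>
        u t (Fin.init h) (h (Fin.last t)).1 (h (Fin.last t)).2.1 :=
      (hu.measurable t).comp (History.measurable_init.prodMk (hl.fst.prodMk hl.snd.fst))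
    have hw : Measurable fun h : History K X (t + 1) =>
        if (confidenceStat u m c b t (Fin.init h)).2 ≤
          c * (confidenceStat u m c b t (Fin.init h)).1 + b
        then u t (Fin.init h) (h (Fin.last t)).1 (h (Fin.last t)).2.1 else 0 :=
      Measurable.ite (measurableSet_le (by fun_prop) (by fun_prop))
        hu' measurable_const
    have hm' : Measurable fun h : History K X (t + 1) =>
        m (h (Fin.last t)).2.1 (h (Fin.last t)).1 :=
      hm.comp (by fun_prop : Measurable fun h : History K X (t + 1) =>
        ((h (Fin.last t)).2.1, (h (Fin.last t)).1))
    simp only [confidenceStat]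
    exact (ih.fst.add hw).prodMk (ih.snd.add (hw.mul (hm'.sub hl.snd.snd)))

theorem IsWeight.confidenceWeight {u : ∀ t, History K X t → X → Fin K → ℝ} (hu : IsWeight u)
    {m : Fin K → X → ℝ} (hm : Measurable fun p : Fin K × X => m p.1 p.2) (c b : ℝ) :
    IsWeight (confidenceWeight u m c b) where
  measurable t := by
    have h := (measurable_confidenceStat hu hm c b t).comp
      (measurable_fst : Measurable (Prod.fst : History K X t × X × Fin K → _))
    exact Measurable.ite (measurableSet_le h.snd ((h.fst.const_mul c).add_const b))
      (hu.measurable t) measurable_const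
  nonneg t h x a := by
    unfold LatentBandit.confidenceWeight
    split_ifs
    exacts [hu.nonneg .., le_rfl]
  le_one t h x a := by
    unfold LatentBandit.confidenceWeight
    split_ifs
    exacts [hu.le_one .., zero_le_one]

theorem confidenceWeight_le {u : ∀ t, History K X t → X → Fin K → ℝ} (hu : IsWeight u)
    (m : Fin K → X → ℝ) (c b : ℝ) (t : ℕ) (h : History K X t) (x : X) (a : Fin K) :
    confidenceWeight u m c b t h x a ≤ u t h x a := by
  unfold LatentBandit.confidenceWeight
  split_ifs
  exacts [le_rfl, hu.nonneg ..]

/-- This is `x + 1 ≤ exp x` at `x = l * noise - l²σ²/2 * count - L`, divided by `l`. It is a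
deviation bound whose failure cost is already in integrable form, so no exceptional event has to be
split off. -/
theorem noise_le (P : Kernel (Fin K × X × S × Θ) ℝ) (v : ∀ t, History K X t → X → Fin K → ℝ)
    (σ L : ℝ) {l : ℝ} (hl : 0 < l) (w : S × Θ) (t : ℕ) (h : History K X t) :
    noise P v w t h ≤ l * σ ^ 2 / 2 * count v t h + L / l +
      Real.exp (-L) / l * expNoise P v σ l w t h := by
  have h1 := Real.add_one_le_exp (l * noise P v w t h - l ^ 2 * σ ^ 2 / 2 * count v t h - L)
  have h2 : Real.exp (l * noise P v w t h - l ^ 2 * σ ^ 2 / 2 * count v t h - L) =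
      Real.exp (-L) * expNoise P v σ l w t h := by
    rw [expNoise, ← Real.exp_add]; ring_nf
  rw [h2] at h1
  refine le_of_mul_le_mul_left ?_ hl
  have h3 : l * (l * σ ^ 2 / 2 * count v t h + L / l +
      Real.exp (-L) / l * expNoise P v σ l w t h) =
      l ^ 2 * σ ^ 2 / 2 * count v t h + L + Real.exp (-L) * expNoise P v σ l w t h := by
    field_simp
  rw [h3]
  linarith

/-- The excess of the confidence weights is controlled up to the first exit of the score, and the
weights vanish afterwards. -/
theorem excess_confidenceWeight_le (P : Kernel (Fin K × X × S × Θ) ℝ)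
    {u : ∀ t, History K X t → X → Fin K → ℝ} (hu : IsWeight u)
    {m : Fin K → X → ℝ} {ε σ L l : ℝ} (hε : 0 ≤ ε) (hL : 0 ≤ L) (hl : 0 < l)
    (w : S × Θ) (hmw : ∀ a x, |m a x - meanReward P a x w.1 w.2| ≤ 1) (t : ℕ) (h : History K X t) :
    excess P (confidenceWeight u m (ε + l * σ ^ 2 / 2) (L / l)) m w t h ≤
      1 + (ε + l * σ ^ 2) * count (confidenceWeight u m (ε + l * σ ^ 2 / 2) (L / l)) t h +
        2 * L / l + Real.exp (-L) / l * cumulative (fun t h _ =>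
          expNoise P (confidenceWeight u m (ε + l * σ ^ 2 / 2) (L / l)) σ l w t h) t h := by
  set v := confidenceWeight u m (ε + l * σ ^ 2 / 2) (L / l) with hv
  -- The last active round varies with the path. Summing the supermartingale over all rounds
  -- dominates its value at that round, since every term is nonnegative.
  have hcumZ : ∀ t h, 0 ≤ cumulative (fun t h _ => expNoise P v σ l w t h) t h := fun t h => by
    have := cumulative_mono (f := fun _ _ _ => 0) (g := fun t h _ => expNoise P v σ l w t h)
      (fun _ _ _ => (Real.exp_pos _).le) t h
    rwa [cumulative_const, mul_zero] at this
  induction t with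
  | zero =>
    simp only [excess, count, cumulative, mul_zero, add_zero]
    positivity
  | succ t ih =>
    set h0 : History K X t := Fin.init h
    set o := h (Fin.last t)
    have e1 : excess P v m w (t + 1) h = excess P v m w t h0 +
        v t h0 o.1 o.2.1 * (m o.2.1 o.1 - meanReward P o.2.1 o.1 w.1 w.2) := rfl
    have e2 : count v (t + 1) h = count v t h0 + v t h0 o.1 o.2.1 := rfl
    have e3 : cumulative (fun t h _ => expNoise P v σ l w t h) (t + 1) h =
      cumulative (fun t h _ => expNoise P v σ l w t h) t h0 + expNoise P v σ l w t h0 := rfl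
    rw [e1, e2, e3]
    have hZ : 0 ≤ Real.exp (-L) / l * expNoise P v σ l w t h0 :=
      mul_nonneg (by positivity) (Real.exp_pos _).le
    -- If the weight is still on, the bound is rebuilt from threshold and noise at the current
    -- history, without the induction hypothesis, and the new round adds at most `1`. If it is off,
    -- nothing is added and the induction hypothesis carries over; the `1` is thus paid once, not
    -- per round.
    by_cases hle : score v m t h0 ≤ (ε + l * σ ^ 2 / 2) * count v t h0 + L / l
    · have hvu : v t h0 o.1 o.2.1 = u t h0 o.1 o.2.1 := confidenceWeight_of_le hle _ _
      have h0v : 0 ≤ v t h0 o.1 o.2.1 := hvu ▸ hu.nonneg ..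
      have h1v : v t h0 o.1 o.2.1 ≤ 1 := hvu ▸ hu.le_one ..
      have hinc : v t h0 o.1 o.2.1 * (m o.2.1 o.1 - meanReward P o.2.1 o.1 w.1 w.2) ≤ 1 :=
        (mul_le_of_le_one_right h0v ((le_abs_self _).trans (hmw _ _))).trans h1v
      have hnoise := noise_le P v σ L hl w t h0
      have hsn := score_add_noise P v m w t h0
      have hc := hcumZ t h0
      have hc' : 0 ≤ Real.exp (-L) / l * cumulative (fun t h _ => expNoise P v σ l w t h) t h0 :=
        mul_nonneg (by positivity) hc
      have hcv : 0 ≤ (ε + l * σ ^ 2) * v t h0 o.1 o.2.1 := mul_nonneg (by positivity) h0v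
      have h2 : 2 * L / l = L / l + L / l := by ring
      rw [h2]
      nlinarith
    · have hv0 : v t h0 o.1 o.2.1 = 0 := confidenceWeight_of_not_le hle _ _
      have := ih h0
      rw [hv0]
      linarith

/-- The score of a prediction which is accurate up to `ε` exits only if the reversed noise is
large. -/
theorem one_le_expNoise_neg (P : Kernel (Fin K × X × S × Θ) ℝ)
    {v : ∀ t, History K X t → X → Fin K → ℝ} (hv : IsWeight v)
    {m : Fin K → X → ℝ} {ε σ L l : ℝ} (hl : 0 < l)
    (w : S × Θ) (hmw : ∀ a x, |m a x - meanReward P a x w.1 w.2| ≤ ε) {t : ℕ} {h : History K X t}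
    (hexit : ¬ score v m t h ≤ (ε + l * σ ^ 2 / 2) * count v t h + L / l) :
    1 ≤ Real.exp (-L) * expNoise P v σ (-l) w t h := by
  rw [expNoise, ← Real.exp_add, Real.one_le_exp_iff]
  -- Accurate predictions keep the excess below `ε * count`. A score above the threshold must
  -- therefore come from noise below `-(lσ²/2 * count + L / l)`.
  have h1 : excess P v m w t h ≤ ε * count v t h := by
    rw [excess, count, ← cumulative_const_mul]
    refine cumulative_mono (fun t h o => ?_) t h
    rw [mul_comm]
    exact mul_le_mul_of_nonneg_right ((le_abs_self _).trans (hmw _ _)) (hv.nonneg ..)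
  have hsn := score_add_noise P v m w t h
  have h2 : l * σ ^ 2 / 2 * count v t h + L / l < - noise P v w t h := by
    rw [not_le] at hexit
    linarith
  have h3 := mul_lt_mul_of_pos_left h2 hl
  have h4 : l * (l * σ ^ 2 / 2 * count v t h + L / l) =
      l ^ 2 * σ ^ 2 / 2 * count v t h + L := by
    field_simp
  rw [h4] at h3
  rw [neg_sq]
  linarith

end Confidence

/-! ### Conditional probabilities given a finite-valued map. -/

section PosteriorWeight

variable {Y α : Type*} [MeasurableSpace Y]

/-- The conditional probability of the event `E` given `f = a`. -/
noncomputable def fiberProb (ν : Measure Y) (f : Y → α) (E : Set Y) (a : α) : ℝ :=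
  ν.real (E ∩ f ⁻¹' {a}) / ν.real (f ⁻¹' {a})

/-- Both sides split over the finitely many fibers of `f`, on each of which `g ∘ f` is constant. On
a null fiber the quotient is `0 / 0 = 0`, which is harmless. -/
theorem integral_indicator_mul_comp [Fintype α] [MeasurableSpace α]
    [MeasurableSingletonClass α] (ν : Measure Y) [IsFiniteMeasure ν] {f : Y → α}
    (hf : Measurable f) {E : Set Y} (hE : MeasurableSet E) (g : α → ℝ) :
    ∫ y, E.indicator 1 y * g (f y) ∂ν = ∫ y, fiberProb ν f E (f y) * g (f y) ∂ν := by
  classical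
  have hfa : ∀ a, MeasurableSet (f ⁻¹' {a}) := fun a => hf (measurableSet_singleton a)
  have h1 : ∀ y, E.indicator (1 : Y → ℝ) y * g (f y) =
      ∑ a, (E ∩ f ⁻¹' {a}).indicator (fun _ => g a) y := by
    intro y
    rw [Finset.sum_eq_single (f y)]
    · by_cases hy : y ∈ E <;> simp [Set.indicator, hy]
    · intro a _ ha
      exact Set.indicator_of_notMem (fun h => ha h.2.symm) _
    · simp
  have h2 : ∀ y, fiberProb ν f E (f y) * g (f y) =
      ∑ a, (f ⁻¹' {a}).indicator (fun _ => fiberProb ν f E a * g a) y := by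
    intro y
    rw [Finset.sum_eq_single (f y)]
    · simp [Set.indicator]
    · intro a _ ha
      exact Set.indicator_of_notMem (fun h => ha h.symm) _
    · simp
  simp only [h1, h2]
  rw [integral_finsetSum _ fun a _ => (integrable_const _).indicator (hE.inter (hfa a)),
    integral_finsetSum _ fun a _ => (integrable_const _).indicator (hfa a)]
  refine Finset.sum_congr rfl fun a _ => ?_
  rw [integral_indicator_const _ (hE.inter (hfa a)), integral_indicator_const _ (hfa a),
    smul_eq_mul, smul_eq_mul, ← mul_assoc, fiberProb]
  congr 1
  by_cases h0 : ν.real (f ⁻¹' {a}) = 0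
  · rw [h0, zero_mul]
    exact le_antisymm (h0 ▸ measureReal_mono Set.inter_subset_right) measureReal_nonneg
  · rw [mul_div_cancel₀ _ h0]

theorem fiberProb_nonneg (ν : Measure Y) (f : Y → α) (E : Set Y) (a : α) :
    0 ≤ fiberProb ν f E a :=
  div_nonneg measureReal_nonneg measureReal_nonneg

theorem fiberProb_le_one (ν : Measure Y) [IsFiniteMeasure ν] (f : Y → α) (E : Set Y) (a : α) :
    fiberProb ν f E a ≤ 1 :=
  div_le_one_of_le₀ (measureReal_mono Set.inter_subset_right) measureReal_nonneg

/-- Disjoint events cut disjoint pieces out of the same fiber. -/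
theorem sum_fiberProb_le_one [MeasurableSpace α] [MeasurableSingletonClass α] {ι : Type*}
    [Fintype ι] (ν : Measure Y) [IsFiniteMeasure ν] {f : Y → α}
    (hf : Measurable f) {E : ι → Set Y} (hE : ∀ i, MeasurableSet (E i))
    (hd : Pairwise (Function.onFun Disjoint E)) (a : α) :
    ∑ i, fiberProb ν f (E i) a ≤ 1 := by
  unfold fiberProb
  rw [← Finset.sum_div]
  refine div_le_one_of_le₀ ?_ measureReal_nonneg
  rw [← measureReal_biUnion_finset
    (fun i _ j _ hij => (hd hij).mono Set.inter_subset_left Set.inter_subset_left)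
    (fun i _ => (hE i).inter (hf (measurableSet_singleton a)))]
  exact measureReal_mono (Set.iUnion₂_subset fun i _ => Set.inter_subset_right)

end PosteriorWeight

/-! ### Conditioning and exchange within a round. -/

section Round

variable {K : ℕ} {X S Θ : Type*} [MeasurableSpace X] [MeasurableSpace S] [MeasurableSpace Θ]
  [StandardBorelSpace S] [StandardBorelSpace Θ] [Nonempty S] [Nonempty Θ]

theorem integral_sampleLaw {t : ℕ} (law : ProbabilityMeasure ((S × Θ) × History K X t))
    (ctx : Kernel (History K X t) X) [IsMarkovKernel ctx]
    {f : ((S × Θ) × History K X t) × (X × (S × Θ)) → ℝ} (hf : Measurable f) {C : ℝ}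
    (hC : ∀ q, |f q| ≤ C) :
    ∫ q, f q ∂sampleLaw law ctx =
      ∫ p, ∫ x, ∫ w, f (p, (x, w)) ∂posterior law p.2 ∂ctx p.2
        ∂(law : Measure ((S × Θ) × History K X t)) := by
  have hi : Integrable f (sampleLaw law ctx) :=
    Integrable.of_bound hf.aestronglyMeasurable C (Filter.Eventually.of_forall hC)
  rw [sampleLaw] at hi ⊢
  rw [Measure.integral_compProd hi]
  refine integral_congr_ae (Filter.Eventually.of_forall fun p => ?_)
  simp only
  rw [Kernel.comap_apply, Kernel.prod_apply, integral_prod]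
  exact Integrable.of_bound (hf.comp measurable_prodMk_left).aestronglyMeasurable C
    (Filter.Eventually.of_forall fun y => hC (p, y))

variable (act : X → S → Θ → Fin K)

/-- The conditional probability that the posterior sample lies in `E`, given the history, the
context and the action. -/
noncomputable def sampleProb {t : ℕ} (law : ProbabilityMeasure ((S × Θ) × History K X t))
    (E : Set (S × Θ)) (h : History K X t) (x : X) (a : Fin K) : ℝ :=
  fiberProb (posterior law h) (fun w => act x w.1 w.2) E a

theorem measurable_sampleProb
    (hact : Measurable fun p : X × S × Θ => act p.1 p.2.1 p.2.2) {t : ℕ} (law : ProbabilityMeasure ((S × Θ) × History K X t))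
    {E : Set (S × Θ)} (hE : MeasurableSet E) :
    Measurable fun p : History K X t × X × Fin K => sampleProb act law E p.1 p.2.1 p.2.2 := by
  let κ : Kernel (History K X t × X × Fin K) (S × Θ) :=
    (posterior law).comap Prod.fst measurable_fst
  have hA : Measurable fun q : (History K X t × X × Fin K) × (S × Θ) =>
      act q.1.2.1 q.2.1 q.2.2 :=
    hact.comp (by fun_prop : Measurable fun q : (History K X t × X × Fin K) × (S × Θ) =>
      (q.1.2.1, q.2.1, q.2.2))
  have hT : MeasurableSet {q : (History K X t × X × Fin K) × (S × Θ) |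
      act q.1.2.1 q.2.1 q.2.2 = q.1.2.2} := measurableSet_eq_fun hA (by fun_prop)
  have h1 := (Kernel.measurable_kernel_prodMk_left (κ := κ)
    ((measurable_snd hE).inter hT)).ennreal_toReal
  have h2 := (Kernel.measurable_kernel_prodMk_left (κ := κ) hT).ennreal_toReal
  exact h1.div h2

/-- For fixed truth, history and context, `g` sees the sample only through the action, so the
indicator can be averaged over the samples that lead to that action. The resulting factor is a
function of observed quantities. -/
theorem integral_indicator_sampleLaw
    (hact : Measurable fun p : X × S × Θ => act p.1 p.2.1 p.2.2) {t : ℕ}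
    (law : ProbabilityMeasure ((S × Θ) × History K X t))
    (ctx : Kernel (History K X t) X) [IsMarkovKernel ctx] {E : Set (S × Θ)} (hE : MeasurableSet E)
    {g : (S × Θ) → History K X t → X → Fin K → ℝ}
    (hg : Measurable fun p : (S × Θ) × History K X t × X × Fin K => g p.1 p.2.1 p.2.2.1 p.2.2.2)
    (hg1 : ∀ w h x a, |g w h x a| ≤ 1) :
    ∫ q, E.indicator 1 q.2.2 * g q.1.1 q.1.2 q.2.1 (act q.2.1 q.2.2.1 q.2.2.2)
        ∂sampleLaw law ctx =
      ∫ q, sampleProb act law E q.1.2 q.2.1 (act q.2.1 q.2.2.1 q.2.2.2) *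
        g q.1.1 q.1.2 q.2.1 (act q.2.1 q.2.2.1 q.2.2.2) ∂sampleLaw law ctx := by
  have hA : Measurable fun q : ((S × Θ) × History K X t) × (X × (S × Θ)) =>
      act q.2.1 q.2.2.1 q.2.2.2 := hact.comp measurable_snd
  have hgA : Measurable fun q : ((S × Θ) × History K X t) × (X × (S × Θ)) =>
      g q.1.1 q.1.2 q.2.1 (act q.2.1 q.2.2.1 q.2.2.2) :=
    hg.comp (Measurable.prodMk (by fun_prop) (Measurable.prodMk (by fun_prop)
      (Measurable.prodMk (by fun_prop) hA)))
  have hI : Measurable fun q : ((S × Θ) × History K X t) × (X × (S × Θ)) =>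
      E.indicator (1 : S × Θ → ℝ) q.2.2 :=
    (measurable_one.indicator hE).comp measurable_snd.snd
  have hu : Measurable fun q : ((S × Θ) × History K X t) × (X × (S × Θ)) =>
      sampleProb act law E q.1.2 q.2.1 (act q.2.1 q.2.2.1 q.2.2.2) :=
    (measurable_sampleProb act hact law hE).comp (Measurable.prodMk (by fun_prop)
      (Measurable.prodMk (by fun_prop) hA))
  have hIg : Measurable fun q : ((S × Θ) × History K X t) × (X × (S × Θ)) =>
      E.indicator (1 : S × Θ → ℝ) q.2.2 * g q.1.1 q.1.2 q.2.1 (act q.2.1 q.2.2.1 q.2.2.2) :=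
    hI.mul hgA
  have hug : Measurable fun q : ((S × Θ) × History K X t) × (X × (S × Θ)) =>
      sampleProb act law E q.1.2 q.2.1 (act q.2.1 q.2.2.1 q.2.2.2) *
        g q.1.1 q.1.2 q.2.1 (act q.2.1 q.2.2.1 q.2.2.2) := hu.mul hgA
  rw [integral_sampleLaw law ctx hIg (C := 1), integral_sampleLaw law ctx hug (C := 1)]
  · refine integral_congr_ae (Filter.Eventually.of_forall fun p => ?_)
    refine integral_congr_ae (Filter.Eventually.of_forall fun x => ?_)
    exact integral_indicator_mul_comp (posterior law p.2)
      (hact.comp (measurable_prodMk_left (x := x))) hE (g p.1 p.2 x)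
  · intro q
    rw [abs_mul, sampleProb, abs_of_nonneg (fiberProb_nonneg _ _ _ _)]
    exact mul_le_one₀ (fiberProb_le_one _ _ _ _) (abs_nonneg _) (hg1 ..)
  · intro q
    rw [abs_mul]
    refine mul_le_one₀ ?_ (abs_nonneg _) (hg1 ..)
    by_cases hq : q.2.2 ∈ E <;> simp [hq]

/-- The expectation of a function of the posterior sample and the history is that of the same
function of the truth and the history. -/
theorem integral_exchange_sampleLaw {t : ℕ} (law : ProbabilityMeasure ((S × Θ) × History K X t))
    (ctx : Kernel (History K X t) X) [IsMarkovKernel ctx]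
    {f : ((S × Θ) × History K X t) × (X × (S × Θ)) → ℝ} (hf : Measurable f) :
    ∫ q, f ((q.2.2, q.1.2), (q.2.1, q.1.1)) ∂sampleLaw law ctx = ∫ q, f q ∂sampleLaw law ctx := by
  conv_rhs => rw [← map_exchange_sampleLaw law ctx]
  exact (integral_map (by fun_prop) hf.aestronglyMeasurable).symm

/-- Needed for the exponential terms, for which no uniform bound is available. -/
theorem integrable_exchange_sampleLaw {t : ℕ}
    (law : ProbabilityMeasure ((S × Θ) × History K X t))
    (ctx : Kernel (History K X t) X) [IsMarkovKernel ctx]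
    {f : (S × Θ) × History K X t → ℝ} (hf : Integrable f (law : Measure _)) :
    Integrable (fun q => f (q.2.2, q.1.2)) (sampleLaw law ctx) := by
  rw [← map_fst_sampleLaw law ctx] at hf
  have h := hf.comp_measurable measurable_fst
  rw [← map_exchange_sampleLaw law ctx] at h
  exact h.comp_measurable (by fun_prop)

/-- The expected regret of a round is the expected amount by which the posterior sample
overestimates the mean reward of the action. -/
theorem integral_regret_eq_integral_overestimate (P : Kernel (Fin K × X × S × Θ) ℝ)
    [IsMarkovKernel P] (hact : Measurable fun p : X × S × Θ => act p.1 p.2.1 p.2.2)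
    (hargmax : IsArgmax P act)
    (hosc : ∀ a x s s' θ θ', |meanReward P a x s θ - meanReward P a x s' θ'| ≤ 1) {t : ℕ}
    (law : ProbabilityMeasure ((S × Θ) × History K X t))
    (ctx : Kernel (History K X t) X) [IsMarkovKernel ctx] :
    ∫ q, (meanReward P (act q.2.1 q.1.1.1 q.1.1.2) q.2.1 q.1.1.1 q.1.1.2 -
        meanReward P (act q.2.1 q.2.2.1 q.2.2.2) q.2.1 q.1.1.1 q.1.1.2) ∂sampleLaw law ctx =
      ∫ q, (meanReward P (act q.2.1 q.2.2.1 q.2.2.2) q.2.1 q.2.2.1 q.2.2.2 -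
        meanReward P (act q.2.1 q.2.2.1 q.2.2.2) q.2.1 q.1.1.1 q.1.1.2) ∂sampleLaw law ctx := by
  have hμ := measurable_meanReward P
  have hA : Measurable fun q : ((S × Θ) × History K X t) × (X × (S × Θ)) =>
      act q.2.1 q.2.2.1 q.2.2.2 := hact.comp measurable_snd
  have hX : Measurable fun q : ((S × Θ) × History K X t) × (X × (S × Θ)) =>
      (q.2.1, q.1.1.1, q.1.1.2) := by fun_prop
  have hA' : Measurable fun q : ((S × Θ) × History K X t) × (X × (S × Θ)) =>
      act q.2.1 q.1.1.1 q.1.1.2 := hact.comp hX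
  have h1 : Measurable fun q : ((S × Θ) × History K X t) × (X × (S × Θ)) =>
      meanReward P (act q.2.1 q.1.1.1 q.1.1.2) q.2.1 q.1.1.1 q.1.1.2 :=
    hμ.comp (hA'.prodMk hX)
  have h2 : Measurable fun q : ((S × Θ) × History K X t) × (X × (S × Θ)) =>
      meanReward P (act q.2.1 q.2.2.1 q.2.2.2) q.2.1 q.2.2.1 q.2.2.2 :=
    hμ.comp (hA.prodMk (by fun_prop))
  have h3 : Measurable fun q : ((S × Θ) × History K X t) × (X × (S × Θ)) =>
      meanReward P (act q.2.1 q.2.2.1 q.2.2.2) q.2.1 q.1.1.1 q.1.1.2 :=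
    hμ.comp (hA.prodMk hX)
  -- Mean rewards may be unbounded over actions and contexts, so only differences are integrated.
  -- The two optimal values differ by at most `1` even though their maximizers may differ.
  have hle : ∀ x (w w' : S × Θ), meanReward P (act x w.1 w.2) x w.1 w.2 -
      meanReward P (act x w'.1 w'.2) x w'.1 w'.2 ≤ 1 := fun x w w' => by
    have e1 := hargmax x w'.1 w'.2 (act x w.1 w.2)
    have e2 := (abs_le.1 (hosc (act x w.1 w.2) x w.1 w'.1 w.2 w'.2)).2
    linarith
  have hΔ : Integrable (fun q : ((S × Θ) × History K X t) × (X × (S × Θ)) =>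
      meanReward P (act q.2.1 q.1.1.1 q.1.1.2) q.2.1 q.1.1.1 q.1.1.2 -
        meanReward P (act q.2.1 q.2.2.1 q.2.2.2) q.2.1 q.2.2.1 q.2.2.2) (sampleLaw law ctx) :=
    Integrable.of_bound (h1.sub h2).aestronglyMeasurable 1 (Filter.Eventually.of_forall fun q => by
      rw [Real.norm_eq_abs, abs_le]
      have e1 := hle q.2.1 q.1.1 q.2.2
      have e2 := hle q.2.1 q.2.2 q.1.1
      constructor <;> linarith)
  have hG : Integrable (fun q : ((S × Θ) × History K X t) × (X × (S × Θ)) =>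
      meanReward P (act q.2.1 q.2.2.1 q.2.2.2) q.2.1 q.2.2.1 q.2.2.2 -
        meanReward P (act q.2.1 q.2.2.1 q.2.2.2) q.2.1 q.1.1.1 q.1.1.2) (sampleLaw law ctx) :=
    Integrable.of_bound (h2.sub h3).aestronglyMeasurable 1
      (Filter.Eventually.of_forall fun q => hosc ..)
  -- The difference of the optimal values changes sign under the exchange, so its integral equals
  -- its own negative.
  have hzero := integral_exchange_sampleLaw law ctx (h1.sub h2)
  have hneg : ∀ q : ((S × Θ) × History K X t) × (X × (S × Θ)),
      (fun q : ((S × Θ) × History K X t) × (X × (S × Θ)) =>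
        meanReward P (act q.2.1 q.1.1.1 q.1.1.2) q.2.1 q.1.1.1 q.1.1.2 -
        meanReward P (act q.2.1 q.2.2.1 q.2.2.2) q.2.1 q.2.2.1 q.2.2.2)
          ((q.2.2, q.1.2), (q.2.1, q.1.1)) =
      -(meanReward P (act q.2.1 q.1.1.1 q.1.1.2) q.2.1 q.1.1.1 q.1.1.2 -
        meanReward P (act q.2.1 q.2.2.1 q.2.2.2) q.2.1 q.2.2.1 q.2.2.2) := fun q => by
    simp only [neg_sub]
  have hzero' := (integral_congr_ae (Filter.Eventually.of_forall hneg)).symm.trans hzero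
  rw [integral_neg] at hzero'
  have hz : ∫ q, (meanReward P (act q.2.1 q.1.1.1 q.1.1.2) q.2.1 q.1.1.1 q.1.1.2 -
        meanReward P (act q.2.1 q.2.2.1 q.2.2.2) q.2.1 q.2.2.1 q.2.2.2) ∂sampleLaw law ctx = 0 := by
    simp only [Pi.sub_apply] at hzero'
    linarith
  rw [← zero_add (∫ q, (meanReward P (act q.2.1 q.2.2.1 q.2.2.2) q.2.1 q.2.2.1 q.2.2.2 -
        meanReward P (act q.2.1 q.2.2.1 q.2.2.2) q.2.1 q.1.1.1 q.1.1.2) ∂sampleLaw law ctx),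
    ← hz, ← integral_add hΔ hG]
  refine integral_congr_ae (Filter.Eventually.of_forall fun q => ?_)
  simp only
  ring

end Round

/-! ### The expected regret of one round. -/

section Regret

variable {K : ℕ} {X S Θ : Type*} [MeasurableSpace X]
  [Fintype S] [Nonempty S] [MeasurableSpace S] [MeasurableSingletonClass S]
  [MeasurableSpace Θ] [StandardBorelSpace Θ] [Nonempty Θ]
  (P : Kernel (Fin K × X × S × Θ) ℝ) [IsMarkovKernel P]
  (prior : Measure (S × Θ)) [IsProbabilityMeasure prior]
  (ctx : ∀ t, Kernel (History K X t) X) [∀ t, IsMarkovKernel (ctx t)]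
  (act : X → S → Θ → Fin K) (hact : Measurable fun p : X × S × Θ => act p.1 p.2.1 p.2.2)

/-- The interaction never redraws the truth, so the prior probability of `Gᶜ` is available in every
round. -/
theorem map_fst_mmTSLaw (t : ℕ) :
    (mmTSLaw P prior ctx act hact t : Measure ((S × Θ) × History K X t)).map Prod.fst = prior := by
  induction t with
  | zero =>
    have h0 : (mmTSLaw P prior ctx act hact 0 : Measure ((S × Θ) × History K X 0)) =
      prior.map fun w => (w, fun i => i.elim0) := rfl
    rw [h0, Measure.map_map measurable_fst (by fun_prop)]
    exact Measure.map_id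
  | succ t ih =>
    have hm : Measurable fun p : (S × Θ) × History K X (t + 1) =>
        (p.1, (Fin.init p.2 : History K X t)) :=
      measurable_fst.prodMk (History.measurable_init.comp measurable_snd)
    rw [← map_init_mmTSLaw P prior ctx act hact t, Measure.map_map measurable_fst hm] at ih
    exact ih

/-- The conditional probability that the sampled state is `s` and the sampled model lies in `G`,
given the history, the context and the action. -/
noncomputable def stateWeight (G : Set Θ) (s : S) (t : ℕ) (h : History K X t) (x : X)
    (a : Fin K) : ℝ :=
  sampleProb act (mmTSLaw P prior ctx act hact t) ({s} ×ˢ G) h x a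

theorem isWeight_stateWeight {G : Set Θ} (hG : MeasurableSet G) (s : S) :
    IsWeight (stateWeight P prior ctx act hact G s) where
  measurable _ := measurable_sampleProb act hact _ ((measurableSet_singleton s).prod hG)
  nonneg _ _ _ _ := fiberProb_nonneg _ _ _ _
  le_one _ _ _ _ := fiberProb_le_one _ _ _ _

theorem sum_stateWeight_le_one {G : Set Θ} (hG : MeasurableSet G) (t : ℕ) (h : History K X t)
    (x : X) (a : Fin K) : ∑ s, stateWeight P prior ctx act hact G s t h x a ≤ 1 := by
  refine sum_fiberProb_le_one _ (hact.comp (measurable_prodMk_left (x := x)))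
    (fun s => (measurableSet_singleton s).prod hG) (fun s s' hs => ?_) a
  exact Set.Disjoint.set_prod_left (Set.disjoint_singleton.2 hs) _ _

variable {P act}

/-- The regret of one round is at most the excess of the confidence weights, up to the accuracy of
the predictions and to the probability that they fail. -/
theorem integral_round_regret_le (hargmax : IsArgmax P act) {σ : ℝ≥0}
    (hsubG : ∀ a x s θ,
      HasSubgaussianMGF (fun r => r - meanReward P a x s θ) (σ ^ 2) (P (a, x, s, θ)))
    (hosc : ∀ a x s s' θ θ', |meanReward P a x s θ - meanReward P a x s' θ'| ≤ 1)
    {m : S → Fin K → X → ℝ} (hm : ∀ s, Measurable fun p : Fin K × X => m s p.1 p.2)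
    (hm1 : ∀ s a x s' θ, |m s a x - meanReward P a x s' θ| ≤ 1)
    {G : Set Θ} (hG : MeasurableSet G) {ε δ : ℝ} (hε : 0 ≤ ε)
    (hmG : ∀ θ ∈ G, ∀ s a x, |m s a x - meanReward P a x s θ| ≤ ε)
    (hδ : prior.snd.real Gᶜ ≤ δ) (L : ℝ) {l : ℝ} (hl : 0 < l) (t : ℕ) :
    ∫ q, (meanReward P (act q.2.1 q.1.1.1 q.1.1.2) q.2.1 q.1.1.1 q.1.1.2 -
        meanReward P (act q.2.1 q.2.2.1 q.2.2.2) q.2.1 q.1.1.1 q.1.1.2)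
        ∂sampleLaw (mmTSLaw P prior ctx act hact t) (ctx t) ≤
      δ + Fintype.card S * Real.exp (-L) + ε +
        ∑ s, ∫ q, confidenceWeight (stateWeight P prior ctx act hact G s) (m s)
            (ε + l * σ ^ 2 / 2) (L / l) t q.1.2 q.2.1 (act q.2.1 q.2.2.1 q.2.2.2) *
          (m s (act q.2.1 q.2.2.1 q.2.2.2) q.2.1 -
            meanReward P (act q.2.1 q.2.2.1 q.2.2.2) q.2.1 q.1.1.1 q.1.1.2)
          ∂sampleLaw (mmTSLaw P prior ctx act hact t) (ctx t) := by
  classical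
  set law := mmTSLaw P prior ctx act hact t with hlaw
  set u := stateWeight P prior ctx act hact G with hu
  set v : S → ∀ t, History K X t → X → Fin K → ℝ :=
    fun s => confidenceWeight (u s) (m s) (ε + l * σ ^ 2 / 2) (L / l) with hv
  have huw : ∀ s, IsWeight (u s) := fun s => isWeight_stateWeight P prior ctx act hact hG s
  have hvw : ∀ s, IsWeight (v s) := fun s => (huw s).confidenceWeight (hm s) _ _
  let C : S → Set (History K X t) := fun s =>
    {h | score (v s) (m s) t h ≤ (ε + l * σ ^ 2 / 2) * count (v s) t h + L / l}
  have hC : ∀ s, MeasurableSet (C s) := fun s => by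
    have h := measurable_confidenceStat (huw s) (hm s) (ε + l * σ ^ 2 / 2) (L / l) t
    simp only [funext (confidenceStat_eq (u s) (m s) (ε + l * σ ^ 2 / 2) (L / l) t)] at h
    exact measurableSet_le h.snd ((h.fst.const_mul _).add_const _)
  let g : S → (S × Θ) → History K X t → X → Fin K → ℝ := fun s w h x a =>
    (C s).indicator 1 h * (m s a x - meanReward P a x w.1 w.2)
  have hg : ∀ s, Measurable fun p : (S × Θ) × History K X t × X × Fin K =>
      g s p.1 p.2.1 p.2.2.1 p.2.2.2 := fun s => by
    have e1 : Measurable fun p : (S × Θ) × History K X t × X × Fin K =>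
        (C s).indicator (1 : History K X t → ℝ) p.2.1 :=
      (measurable_one.indicator (hC s)).comp measurable_snd.fst
    have e2 : Measurable fun p : (S × Θ) × History K X t × X × Fin K => m s p.2.2.2 p.2.2.1 :=
      (hm s).comp (measurable_snd.snd.snd.prodMk measurable_snd.snd.fst)
    have e3 : Measurable fun p : (S × Θ) × History K X t × X × Fin K =>
        meanReward P p.2.2.2 p.2.2.1 p.1.1 p.1.2 :=
      (measurable_meanReward P).comp (measurable_snd.snd.snd.prodMk
        (measurable_snd.snd.fst.prodMk measurable_fst))
    exact e1.mul (e2.sub e3)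
  have hg1 : ∀ s w h x a, |g s w h x a| ≤ 1 := fun s w h x a => by
    by_cases hh : h ∈ C s
    · simpa [g, hh] using hm1 s a x w.1 w.2
    · simp [g, hh]
  have hE : ∀ s : S, MeasurableSet (({s} : Set S) ×ˢ G) :=
    fun s => (measurableSet_singleton s).prod hG
  -- The stopping rule depends on the history alone, so it can be moved into `g`, and the weight
  -- turns back into the indicator of the sampled state and model.
  have hterm : ∀ s, ∫ q, v s t q.1.2 q.2.1 (act q.2.1 q.2.2.1 q.2.2.2) *
          (m s (act q.2.1 q.2.2.1 q.2.2.2) q.2.1 -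
            meanReward P (act q.2.1 q.2.2.1 q.2.2.2) q.2.1 q.1.1.1 q.1.1.2)
          ∂sampleLaw law (ctx t) =
      ∫ q, (({s} : Set S) ×ˢ G).indicator 1 q.2.2 *
        g s q.1.1 q.1.2 q.2.1 (act q.2.1 q.2.2.1 q.2.2.2) ∂sampleLaw law (ctx t) := fun s => by
    rw [integral_indicator_sampleLaw act hact law (ctx t) (hE s) (hg s) (hg1 s)]
    refine integral_congr_ae (Filter.Eventually.of_forall fun q => ?_)
    simp only [g]
    by_cases hh : q.1.2 ∈ C s
    · have : v s t q.1.2 q.2.1 (act q.2.1 q.2.2.1 q.2.2.2) =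
          u s t q.1.2 q.2.1 (act q.2.1 q.2.2.1 q.2.2.2) := confidenceWeight_of_le hh _ _
      rw [this, Set.indicator_of_mem hh, Pi.one_apply, one_mul]
      rfl
    · have : v s t q.1.2 q.2.1 (act q.2.1 q.2.2.1 q.2.2.2) = 0 :=
        confidenceWeight_of_not_le hh _ _
      rw [this, Set.indicator_of_notMem hh, zero_mul, mul_zero]
  have htermI : ∀ s, Integrable (fun q : ((S × Θ) × History K X t) × (X × (S × Θ)) =>
      (({s} : Set S) ×ˢ G).indicator 1 q.2.2 *
        g s q.1.1 q.1.2 q.2.1 (act q.2.1 q.2.2.1 q.2.2.2)) (sampleLaw law (ctx t)) := fun s => by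
    have hA : Measurable fun q : ((S × Θ) × History K X t) × (X × (S × Θ)) =>
        act q.2.1 q.2.2.1 q.2.2.2 := hact.comp measurable_snd
    have hgA : Measurable fun q : ((S × Θ) × History K X t) × (X × (S × Θ)) =>
        g s q.1.1 q.1.2 q.2.1 (act q.2.1 q.2.2.1 q.2.2.2) :=
      (hg s).comp (Measurable.prodMk (by fun_prop) (Measurable.prodMk (by fun_prop)
        (Measurable.prodMk (by fun_prop) hA)))
    refine Integrable.of_bound (((measurable_one.indicator (hE s)).comp
      measurable_snd.snd).mul hgA).aestronglyMeasurable 1 (Filter.Eventually.of_forall fun q => ?_)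
    rw [Real.norm_eq_abs, abs_mul]
    refine mul_le_one₀ ?_ (abs_nonneg _) (hg1 ..)
    by_cases hq : q.2.2 ∈ ({s} : Set S) ×ˢ G
    · rw [Set.indicator_of_mem hq]; simp
    · rw [Set.indicator_of_notMem hq]; simp
  -- The cost of failure: the sampled model is outside `G`, or the sampled state has been switched
  -- off. It involves only the sample and the history, so exchange replaces the sample by the truth,
  -- under which the supermartingale bound holds. All states are summed because the sampled one is
  -- random.
  let B : (S × Θ) × History K X t → ℝ := fun p =>
    Gᶜ.indicator 1 p.1.2 + ∑ s, Real.exp (-L) * expNoise P (v s) σ (-l) p.1 t p.2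
  have hZ : ∀ s, Integrable (fun p : (S × Θ) × History K X t =>
      Real.exp (-L) * expNoise P (v s) σ (-l) p.1 t p.2) (law : Measure _) := fun s =>
    ((hvw s).integrable_expNoise P prior ctx act hact hsubG (-l) t).const_mul _
  have hI : Integrable (fun p : (S × Θ) × History K X t =>
      Gᶜ.indicator (1 : Θ → ℝ) p.1.2) (law : Measure _) := by
    refine Integrable.of_bound ((measurable_one.indicator hG.compl).comp
      measurable_fst.snd).aestronglyMeasurable 1 (Filter.Eventually.of_forall fun p => ?_)
    by_cases hp : p.1.2 ∈ G <;> simp [hp]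
  have hsumI : Integrable (fun p : (S × Θ) × History K X t =>
      ∑ s, Real.exp (-L) * expNoise P (v s) σ (-l) p.1 t p.2) (law : Measure _) :=
    integrable_finsetSum _ fun s _ => hZ s
  have hBI : Integrable B (law : Measure _) := hI.add hsumI
  have hBm : Measurable B :=
    ((measurable_one.indicator hG.compl).comp measurable_fst.snd).add
      (Finset.measurable_fun_sum _ fun s _ => ((hvw s).measurable_expNoise P σ (-l) t).const_mul _)
  have hBle : ∫ q, B (q.2.2, q.1.2) ∂sampleLaw law (ctx t) ≤
      δ + Fintype.card S * Real.exp (-L) := by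
    have e1 := integral_exchange_sampleLaw law (ctx t) (f := fun q => B q.1)
      (hBm.comp measurable_fst)
    simp only at e1
    rw [e1, integral_fst_sampleLaw _ _ hBm, integral_add hI hsumI,
      integral_finsetSum _ fun s _ => hZ s]
    refine add_le_add ?_ ?_
    · refine le_trans (le_of_eq ?_) hδ
      have e2 : (law : Measure ((S × Θ) × History K X t)).map (fun p => p.1.2) = prior.snd := by
        rw [← map_fst_mmTSLaw P prior ctx act hact t, Measure.snd,
          Measure.map_map measurable_snd measurable_fst]
        rfl
      rw [← integral_indicator_one hG.compl, ← e2,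
        integral_map measurable_fst.snd.aemeasurable
          (measurable_one.indicator hG.compl).aestronglyMeasurable]
    · rw [← nsmul_eq_mul, ← Finset.card_univ]
      refine Finset.sum_le_card_nsmul _ _ _ fun s _ => ?_
      rw [integral_const_mul]
      exact mul_le_of_le_one_right (Real.exp_pos _).le
        ((hvw s).integral_expNoise_le P prior ctx act hact hsubG (-l) t)
  have hBI' := integrable_exchange_sampleLaw law (ctx t) hBI
  have hBε : Integrable (fun q : ((S × Θ) × History K X t) × (X × (S × Θ)) =>
      B (q.2.2, q.1.2) + ε) (sampleLaw law (ctx t)) := hBI'.add (integrable_const ε)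
  rw [integral_regret_eq_integral_overestimate act P hact hargmax hosc law (ctx t)]
  have hright : ∫ q, (B (q.2.2, q.1.2) + ε + ∑ s, (({s} : Set S) ×ˢ G).indicator 1 q.2.2 *
        g s q.1.1 q.1.2 q.2.1 (act q.2.1 q.2.2.1 q.2.2.2)) ∂sampleLaw law (ctx t) ≤
      δ + Fintype.card S * Real.exp (-L) + ε +
        ∑ s, ∫ q, (({s} : Set S) ×ˢ G).indicator 1 q.2.2 *
        g s q.1.1 q.1.2 q.2.1 (act q.2.1 q.2.2.1 q.2.2.2) ∂sampleLaw law (ctx t) := by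
    rw [integral_add hBε (integrable_finsetSum _ fun s _ => htermI s),
      integral_add hBI' (integrable_const ε), integral_finsetSum _ fun s _ => htermI s,
      integral_const, probReal_univ, one_smul]
    gcongr
  refine le_trans ?_ (hright.trans (le_of_eq (congrArg _
    (Finset.sum_congr rfl fun s _ => (hterm s).symm))))
  have hA : Measurable fun q : ((S × Θ) × History K X t) × (X × (S × Θ)) =>
      act q.2.1 q.2.2.1 q.2.2.2 := hact.comp measurable_snd
  have hX : Measurable fun q : ((S × Θ) × History K X t) × (X × (S × Θ)) =>
      (q.2.1, q.1.1.1, q.1.1.2) := by fun_prop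
  have hgap : Measurable fun q : ((S × Θ) × History K X t) × (X × (S × Θ)) =>
      meanReward P (act q.2.1 q.2.2.1 q.2.2.2) q.2.1 q.2.2.1 q.2.2.2 -
        meanReward P (act q.2.1 q.2.2.1 q.2.2.2) q.2.1 q.1.1.1 q.1.1.2 :=
    ((measurable_meanReward P).comp (hA.prodMk measurable_snd)).sub
      ((measurable_meanReward P).comp (hA.prodMk hX))
  refine integral_mono (Integrable.of_bound hgap.aestronglyMeasurable 1
    (Filter.Eventually.of_forall fun q => hosc ..))
    (hBε.add (integrable_finsetSum _ fun s _ => htermI s)) fun q => ?_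
  obtain ⟨⟨w, h⟩, x, b, θ⟩ := q
  have hsum : ∑ s, (({s} : Set S) ×ˢ G).indicator 1 (b, θ) * g s w h x (act x b θ) =
      G.indicator 1 θ * g b w h x (act x b θ) := by
    rw [Finset.sum_eq_single b]
    · by_cases hθ : θ ∈ G <;> simp [Set.indicator, hθ]
    · intro s _ hs
      simp [Set.indicator, hs.symm]
    · simp
  have hZ0 : ∀ s, 0 ≤ Real.exp (-L) * expNoise P (v s) σ (-l) (b, θ) t h := fun s =>
    mul_nonneg (Real.exp_pos _).le (Real.exp_pos _).le
  have hgap1 := (abs_le.1 (hosc (act x b θ) x b w.1 θ w.2)).2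
  have hZs := Finset.sum_nonneg fun s (_ : s ∈ Finset.univ) => hZ0 s
  simp only [B]
  rw [hsum]
  -- Three cases: an active state uses the prediction `m b` with error `ε`. A switched-off state has
  -- gap at most `1`, paid by its exponential term. A model outside `G` has gap at most `1`, paid by
  -- the indicator of `Gᶜ`.
  by_cases hθ : θ ∈ G
  · have hmb := (abs_le.1 (hmG θ hθ b (act x b θ) x)).1
    by_cases hh : h ∈ C b
    · simp only [g, Set.indicator_of_mem hθ, Set.indicator_of_mem hh,
        Set.indicator_of_notMem (Set.notMem_compl_iff.2 hθ), Pi.one_apply, one_mul]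
      linarith
    · have h1 := one_le_expNoise_neg P (hvw b) hl (b, θ) (hmG θ hθ b) hh
      have h2 := h1.trans (Finset.single_le_sum (fun s _ => hZ0 s) (Finset.mem_univ b))
      simp only [g, Set.indicator_of_mem hθ, Set.indicator_of_notMem hh,
        Set.indicator_of_notMem (Set.notMem_compl_iff.2 hθ), zero_mul, mul_zero]
      linarith
  · simp only [Set.indicator_of_notMem hθ, Set.indicator_of_mem (Set.mem_compl hθ), Pi.one_apply,
      zero_mul]
    linarith

end Regret

theorem regret_eq_cumulative {K : ℕ} {X S Θ : Type*} [MeasurableSpace X] [MeasurableSpace S]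
    [MeasurableSpace Θ] (P : Kernel (Fin K × X × S × Θ) ℝ) (act : X → S → Θ → Fin K)
    (w : S × Θ) : ∀ n (h : History K X n), regret P act n (w, h) =
      cumulative (fun _ _ o => meanReward P (act o.1 w.1 w.2) o.1 w.1 w.2 -
        meanReward P o.2.1 o.1 w.1 w.2) n h
  | 0, _ => rfl
  | n + 1, h => by
    have ih := regret_eq_cumulative P act w n (Fin.init h)
    rw [cumulative, ← ih]
    exact Fin.sum_univ_castSucc _

/-! ### Bounds and measurability of the realized regret. -/

section RealizedRegret

variable {K : ℕ} {X S Θ : Type*} [MeasurableSpace X] [MeasurableSpace S] [MeasurableSpace Θ]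
  {P : Kernel (Fin K × X × S × Θ) ℝ} {act : X → S → Θ → Fin K}

theorem abs_round_regret_le (hargmax : IsArgmax P act)
    (hsubopt : ∀ a a' x s θ, meanReward P a' x s θ - meanReward P a x s θ ≤ 1)
    (w : S × Θ) (x : X) (a : Fin K) :
    |meanReward P (act x w.1 w.2) x w.1 w.2 - meanReward P a x w.1 w.2| ≤ 1 :=
  abs_le.2 ⟨by linarith [hargmax x w.1 w.2 a], hsubopt ..⟩

theorem abs_regret_le (hargmax : IsArgmax P act)
    (hsubopt : ∀ a a' x s θ, meanReward P a' x s θ - meanReward P a x s θ ≤ 1)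
    (n : ℕ) (ω : (S × Θ) × History K X n) : |regret P act n ω| ≤ n := by
  rw [← Prod.mk.eta (p := ω), regret_eq_cumulative]
  exact abs_cumulative_le (fun t h o => abs_round_regret_le hargmax hsubopt _ _ _) _ _

theorem measurable_round_regret [IsMarkovKernel P]
    (hact : Measurable fun p : X × S × Θ => act p.1 p.2.1 p.2.2) :
    Measurable fun p : (S × Θ) × X × Fin K =>
      meanReward P (act p.2.1 p.1.1 p.1.2) p.2.1 p.1.1 p.1.2 -
        meanReward P p.2.2 p.2.1 p.1.1 p.1.2 := by
  have hX : Measurable fun p : (S × Θ) × X × Fin K => (p.2.1, p.1.1, p.1.2) := by fun_prop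
  exact ((measurable_meanReward P).comp ((hact.comp hX).prodMk hX)).sub
    ((measurable_meanReward P).comp (measurable_snd.snd.prodMk hX))

theorem measurable_regret [IsMarkovKernel P]
    (hact : Measurable fun p : X × S × Θ => act p.1 p.2.1 p.2.2) (n : ℕ) :
    Measurable (regret P act n) := by
  have h : regret P act n = fun ω => cumulative (fun _ _ o =>
      meanReward P (act o.1 ω.1.1 ω.1.2) o.1 ω.1.1 ω.1.2 -
        meanReward P o.2.1 o.1 ω.1.1 ω.1.2) n ω.2 :=
    funext fun ω => regret_eq_cumulative P act ω.1 n ω.2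
  rw [h]
  exact measurable_cumulative (W := S × Θ) (f := fun w _ _ o =>
    meanReward P (act o.1 w.1 w.2) o.1 w.1 w.2 - meanReward P o.2.1 o.1 w.1 w.2)
    (fun t => (measurable_round_regret hact).comp (by fun_prop :
      Measurable fun p : (S × Θ) × History K X t × (X × Fin K × ℝ) =>
        (p.1, p.2.2.1, p.2.2.2.1))) n

end RealizedRegret

/-! ### Summation over rounds and states. -/

section Bound

variable {K : ℕ} {X S Θ : Type*} [MeasurableSpace X]
  [Fintype S] [Nonempty S] [MeasurableSpace S] [MeasurableSingletonClass S]
  [MeasurableSpace Θ] [StandardBorelSpace Θ] [Nonempty Θ]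
  {P : Kernel (Fin K × X × S × Θ) ℝ} [IsMarkovKernel P]
  (prior : Measure (S × Θ)) [IsProbabilityMeasure prior]
  (ctx : ∀ t, Kernel (History K X t) X) [∀ t, IsMarkovKernel (ctx t)]
  {act : X → S → Θ → Fin K} (hact : Measurable fun p : X × S × Θ => act p.1 p.2.1 p.2.2)

theorem integrable_regret (hargmax : IsArgmax P act)
    (hsubopt : ∀ a a' x s θ, meanReward P a' x s θ - meanReward P a x s θ ≤ 1) (n : ℕ) :
    Integrable (regret P act n)
      (mmTSLaw P prior ctx act hact n : Measure ((S × Θ) × History K X n)) :=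
  Integrable.of_bound (measurable_regret hact n).aestronglyMeasurable n
    (Filter.Eventually.of_forall fun ω => abs_regret_le hargmax hsubopt n ω)

/-- The Bayes regret for arbitrary confidence parameters `l` and `L`. -/
theorem bayesRegret_le_of_params (hargmax : IsArgmax P act) {σ : ℝ≥0}
    (hsubG : ∀ a x s θ,
      HasSubgaussianMGF (fun r => r - meanReward P a x s θ) (σ ^ 2) (P (a, x, s, θ)))
    (hsubopt : ∀ a a' x s θ, meanReward P a' x s θ - meanReward P a x s θ ≤ 1)
    (hosc : ∀ a x s s' θ θ', |meanReward P a x s θ - meanReward P a x s' θ'| ≤ 1)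
    {m : S → Fin K → X → ℝ} (hm : ∀ s, Measurable fun p : Fin K × X => m s p.1 p.2)
    (hm1 : ∀ s a x s' θ, |m s a x - meanReward P a x s' θ| ≤ 1)
    {G : Set Θ} (hG : MeasurableSet G) {ε δ : ℝ} (hε : 0 ≤ ε)
    (hmG : ∀ θ ∈ G, ∀ s a x, |m s a x - meanReward P a x s θ| ≤ ε)
    (hδ : prior.snd.real Gᶜ ≤ δ) {L : ℝ} (hL : 0 ≤ L) {l : ℝ} (hl : 0 < l) (n : ℕ) :
    bayesRegret P prior ctx act hact n ≤
      n * (δ + Fintype.card S * Real.exp (-L) + ε) + (Fintype.card S + (ε + l * σ ^ 2) * n +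
        Fintype.card S * (2 * L / l) + Fintype.card S * (Real.exp (-L) / l * n)) := by
  set u := stateWeight P prior ctx act hact G with hu
  set v : S → ∀ t, History K X t → X → Fin K → ℝ :=
    fun s => confidenceWeight (u s) (m s) (ε + l * σ ^ 2 / 2) (L / l) with hv
  have huw : ∀ s, IsWeight (u s) := fun s => isWeight_stateWeight P prior ctx act hact hG s
  have hvw : ∀ s, IsWeight (v s) := fun s => (huw s).confidenceWeight (hm s) _ _
  have hXm : ∀ s, ∀ t, Measurable fun p : (S × Θ) × History K X t × X × Fin K =>
      v s t p.2.1 p.2.2.1 p.2.2.2 *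
        (m s p.2.2.2 p.2.2.1 - meanReward P p.2.2.2 p.2.2.1 p.1.1 p.1.2) := fun s t =>
    (((hvw s).measurable t).comp measurable_snd).mul
      (((hm s).comp (measurable_snd.snd.snd.prodMk measurable_snd.snd.fst)).sub
        ((measurable_meanReward P).comp (measurable_snd.snd.snd.prodMk
          (measurable_snd.snd.fst.prodMk measurable_fst))))
  have hX1 : ∀ s (w : S × Θ) t h x a, |v s t h x a * (m s a x - meanReward P a x w.1 w.2)| ≤ 1 :=
    fun s w t h x a => by
      rw [abs_mul, abs_of_nonneg ((hvw s).nonneg ..)]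
      exact mul_le_one₀ ((hvw s).le_one ..) (abs_nonneg _) (hm1 ..)
  have hexcess : ∀ n, ∫ ω, regret P act n ω
        ∂(mmTSLaw P prior ctx act hact n : Measure ((S × Θ) × History K X n)) ≤
      n * (δ + Fintype.card S * Real.exp (-L) + ε) + ∑ s, ∫ ω, excess P (v s) (m s) ω.1 n ω.2
        ∂(mmTSLaw P prior ctx act hact n : Measure ((S × Θ) × History K X n)) := by
    intro n
    induction n with
    | zero => simp [regret, excess, cumulative]
    | succ t ih =>
      have e1 := integral_cumulative_succ P prior ctx act hact
        (g := fun w _ _ x a => meanReward P (act x w.1 w.2) x w.1 w.2 - meanReward P a x w.1 w.2)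
        (fun t => (measurable_round_regret hact).comp (by fun_prop :
          Measurable fun p : (S × Θ) × History K X t × X × Fin K => (p.1, p.2.2.1, p.2.2.2)))
        (fun w t h x a => abs_round_regret_le hargmax hsubopt w x a) t
      have e2 := fun s => integral_cumulative_succ P prior ctx act hact
        (g := fun w t h x a => v s t h x a * (m s a x - meanReward P a x w.1 w.2))
        (hXm s) (hX1 s) t
      have e3 := integral_round_regret_le prior ctx hact hargmax hsubG hosc hm hm1 hG hε hmG hδ L
        hl t
      simp only [← regret_eq_cumulative, Prod.mk.eta] at e1
      have e4 : ∑ s, ∫ ω, excess P (v s) (m s) ω.1 (t + 1) ω.2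
          ∂(mmTSLaw P prior ctx act hact (t + 1) : Measure ((S × Θ) × History K X (t + 1))) =
        ∑ s, ∫ ω, excess P (v s) (m s) ω.1 t ω.2
          ∂(mmTSLaw P prior ctx act hact t : Measure ((S × Θ) × History K X t)) +
        ∑ s, ∫ q, v s t q.1.2 q.2.1 (act q.2.1 q.2.2.1 q.2.2.2) *
          (m s (act q.2.1 q.2.2.1 q.2.2.2) q.2.1 -
            meanReward P (act q.2.1 q.2.2.1 q.2.2.2) q.2.1 q.1.1.1 q.1.1.2)
          ∂sampleLaw (mmTSLaw P prior ctx act hact t) (ctx t) := by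
        rw [← Finset.sum_add_distrib]
        exact Finset.sum_congr rfl fun s _ => e2 s
      rw [e1, e4]
      push_cast
      linarith
  refine (hexcess n).trans (add_le_add le_rfl ?_)
  have hexI : ∀ s, Integrable (fun ω => excess P (v s) (m s) ω.1 n ω.2)
      (mmTSLaw P prior ctx act hact n : Measure ((S × Θ) × History K X n)) := fun s =>
    Integrable.of_bound (measurable_cumulative (W := S × Θ) (f := fun w t h o =>
        v s t h o.1 o.2.1 * (m s o.2.1 o.1 - meanReward P o.2.1 o.1 w.1 w.2))
      (fun t => (hXm s t).comp (by fun_prop :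
        Measurable fun p : (S × Θ) × History K X t × (X × Fin K × ℝ) =>
          (p.1, p.2.1, p.2.2.1, p.2.2.2.1))) n).aestronglyMeasurable n
      (Filter.Eventually.of_forall fun ω => abs_cumulative_le (fun t h o => hX1 _ _ _ _ _ _) _ _)
  have hZ := fun s => (hvw s).integral_cumulative_expNoise_le P prior ctx act hact hsubG l n
  have hZI : ∀ s, Integrable (fun ω : (S × Θ) × History K X n => Real.exp (-L) / l *
      cumulative (fun t h _ => expNoise P (v s) σ l ω.1 t h) n ω.2)
      (mmTSLaw P prior ctx act hact n : Measure ((S × Θ) × History K X n)) :=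
    fun s => (hZ s).1.const_mul _
  -- In each round the weights of all states share a total mass of at most `1`, so the linear terms
  -- cost `n` in total rather than `n` per state.
  have hcount : ∀ h : History K X n, ∑ s, count (v s) n h ≤ n := fun h => by
    simp only [count]
    rw [← cumulative_sum]
    refine (cumulative_mono (g := fun _ _ _ => 1) (fun t h o => ?_) n h).trans_eq
      (by rw [cumulative_const, mul_one])
    exact (Finset.sum_le_sum fun s _ => confidenceWeight_le (huw s) _ _ _ _ _ _ _).trans
      (sum_stateWeight_le_one P prior ctx act hact hG t h o.1 o.2.1)
  rw [← integral_finsetSum _ fun s _ => hexI s]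
  have hpath : ∀ ω : (S × Θ) × History K X n, ∑ s, excess P (v s) (m s) ω.1 n ω.2 ≤
      (Fintype.card S + (ε + l * σ ^ 2) * n + Fintype.card S * (2 * L / l)) +
        ∑ s, Real.exp (-L) / l *
          cumulative (fun t h _ => expNoise P (v s) σ l ω.1 t h) n ω.2 := fun ω => by
    have h1 := Finset.sum_le_sum fun s (_ : s ∈ Finset.univ) =>
      excess_confidenceWeight_le P (huw s) (m := m s) (σ := σ) hε hL hl ω.1
        (fun a x => hm1 s a x _ _) n ω.2
    refine h1.trans ?_
    simp only [Finset.sum_add_distrib, Finset.sum_const, Finset.card_univ, nsmul_eq_mul, mul_one,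
      ← Finset.mul_sum]
    have h2 := mul_le_mul_of_nonneg_left (hcount ω.2) (by positivity : 0 ≤ ε + l * (σ : ℝ) ^ 2)
    simp only [hv] at h2 ⊢
    linarith
  refine (integral_mono (integrable_finsetSum _ fun s _ => hexI s)
    ((integrable_const _).add (integrable_finsetSum _ fun s _ => hZI s)) hpath).trans ?_
  rw [integral_add' (integrable_const _) (integrable_finsetSum _ fun s _ => hZI s),
    integral_const, probReal_univ, one_smul, integral_finsetSum _ fun s _ => hZI s]
  refine add_le_add le_rfl ?_
  rw [← nsmul_eq_mul (Fintype.card S), ← Finset.card_univ]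
  refine Finset.sum_le_card_nsmul _ _ _ fun s _ => ?_
  rw [integral_const_mul]
  exact mul_le_mul_of_nonneg_left (hZ s).2 (by positivity)

end Bound

/-! ### The marginal mean as prediction, and the choice of parameters. -/

section MarginalMean

variable {K : ℕ} {X S Θ : Type*} [MeasurableSpace X] [MeasurableSpace S] [MeasurableSpace Θ]

theorem abs_marginalMean_sub_le (P : Kernel (Fin K × X × S × Θ) ℝ) [IsMarkovKernel P]
    (prior : Measure (S × Θ)) [IsProbabilityMeasure prior]
    (hosc : ∀ a x s s' θ θ', |meanReward P a x s θ - meanReward P a x s' θ'| ≤ 1)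
    (a : Fin K) (x : X) (s s' : S) (θ' : Θ) :
    |marginalMean P prior a x s - meanReward P a x s' θ'| ≤ 1 := by
  have hmeas : Measurable fun θ => meanReward P a x s θ :=
    (measurable_meanReward P).comp (by fun_prop : Measurable fun θ : Θ => (a, x, s, θ))
  have hd : Integrable (fun θ => meanReward P a x s θ - meanReward P a x s' θ') prior.snd :=
    Integrable.of_bound (hmeas.sub_const _).aestronglyMeasurable 1
      (Filter.Eventually.of_forall fun θ => hosc ..)
  have hi : Integrable (fun θ => meanReward P a x s θ) prior.snd := by
    refine (hd.add (integrable_const (meanReward P a x s' θ'))).congr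
      (Filter.Eventually.of_forall fun θ => ?_)
    simp
  have h : marginalMean P prior a x s - meanReward P a x s' θ' =
      ∫ θ, (meanReward P a x s θ - meanReward P a x s' θ') ∂prior.snd := by
    rw [integral_sub hi (integrable_const _), integral_const, probReal_univ, one_smul]
    rfl
  rw [h]
  have := norm_integral_le_of_norm_le_const (μ := prior.snd) (C := 1)
    (f := fun θ => meanReward P a x s θ - meanReward P a x s' θ')
    (Filter.Eventually.of_forall fun θ => hosc ..)
  simpa using this

end MarginalMean

/-- The optimal choice of the parameter `l` of the confidence weights. -/
theorem exists_param_le {σ N n C : ℝ} (hσ : 0 ≤ σ) (hN : 1 ≤ N) (hn : 2 ≤ n)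
    (hC : 2 * Real.log n + 1 ≤ C) (hC6 : C ≤ 6 * Real.log n) :
    ∃ l, 0 < l ∧ l * σ ^ 2 * n + N * (C / l) ≤ N + 2 * σ * √(6 * N * n * Real.log n) := by
  have hlog : 0 < Real.log n := Real.log_pos (by linarith)
  have hC0 : 0 < C := by linarith
  rcases hσ.eq_or_lt with rfl | hσ
  · refine ⟨C, hC0, ?_⟩
    rw [div_self hC0.ne']
    simp
  · set r := √(6 * N * n * Real.log n) with hr
    have hr0 : 0 < r := Real.sqrt_pos.2 (by positivity)
    have hr2 : r ^ 2 = 6 * N * n * Real.log n := Real.sq_sqrt (by positivity)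
    -- With this `l` the first term is exactly `σ * r`, and `C ≤ 6 log n` makes the second at most
    -- `σ * r`.
    refine ⟨r / (σ * n), by positivity, ?_⟩
    have h1 : r / (σ * n) * σ ^ 2 * n = σ * r := by field_simp
    have h2 : N * (C / (r / (σ * n))) ≤ σ * r := by
      have : N * (C / (r / (σ * n))) = σ * (N * n * C) / r := by field_simp
      rw [this, div_le_iff₀ hr0, mul_assoc σ r r, ← sq, hr2]
      refine mul_le_mul_of_nonneg_left ?_ hσ.le
      calc N * n * C ≤ N * n * (6 * Real.log n) :=
            mul_le_mul_of_nonneg_left hC6 (by positivity)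
        _ = _ := by ring
    linarith

end LatentBandit

theorem corollary2 {K : ℕ} {X S Θ : Type*} [MeasurableSpace X]
    [Fintype S] [Nonempty S] [MeasurableSpace S] [MeasurableSingletonClass S]
    [MeasurableSpace Θ] [StandardBorelSpace Θ] [Nonempty Θ]
    (P : Kernel (Fin K × X × S × Θ) ℝ) [IsMarkovKernel P]
    (prior : Measure (S × Θ)) [IsProbabilityMeasure prior]
    (ctx : ∀ t, Kernel (LatentBandit.History K X t) X) [∀ t, IsMarkovKernel (ctx t)]
    (act : X → S → Θ → Fin K) (hact : Measurable fun p : X × S × Θ => act p.1 p.2.1 p.2.2)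
    (hargmax : LatentBandit.IsArgmax P act)
    (σ : ℝ≥0)
    (hsubG : ∀ a x s θ,
      HasSubgaussianMGF (fun r => r - LatentBandit.meanReward P a x s θ) (σ ^ 2) (P (a, x, s, θ)))
    (hsubopt : ∀ a a' x s θ,
      LatentBandit.meanReward P a' x s θ - LatentBandit.meanReward P a x s θ ≤ 1)
    (hosc : ∀ a x s s' θ θ',
      |LatentBandit.meanReward P a x s θ - LatentBandit.meanReward P a x s' θ'| ≤ 1)
    (ε δ : ℝ) (hε : 0 < ε) (hδ : 0 < δ)
    (hmeas : NullMeasurableSet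
      {θ | ∀ a x s, |LatentBandit.marginalMean P prior a x s -
        LatentBandit.meanReward P a x s θ| ≤ ε} prior.snd)
    (hclose : 1 - δ ≤ prior.snd.real
      {θ | ∀ a x s, |LatentBandit.marginalMean P prior a x s -
        LatentBandit.meanReward P a x s θ| ≤ ε})
    (n : ℕ) :
    Integrable (LatentBandit.regret P act n)
        (LatentBandit.mmTSLaw P prior ctx act hact n :
          Measure ((S × Θ) × LatentBandit.History K X n)) ∧
      LatentBandit.bayesRegret P prior ctx act hact n ≤
        n * δ + 3 * (Fintype.card S : ℝ) + 2 * n * ε +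
          2 * σ * √(6 * (Fintype.card S : ℝ) * n * Real.log n) := by
  have hint := LatentBandit.integrable_regret prior ctx hact hargmax hsubopt n
  refine ⟨hint, ?_⟩
  have hN : (1 : ℝ) ≤ Fintype.card S := by exact_mod_cast Fintype.card_pos (α := S)
  -- For `n ≤ 1` the logarithm gives nothing, but the regret is at most `n ≤ 1 ≤ 3|S|`.
  rcases lt_or_ge n 2 with hn | hn
  · have h1 : LatentBandit.bayesRegret P prior ctx act hact n ≤ n := by
      refine (integral_mono hint (integrable_const (n : ℝ)) fun ω =>
        (le_abs_self _).trans (LatentBandit.abs_regret_le hargmax hsubopt n ω)).trans_eq ?_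
      rw [integral_const, probReal_univ, one_smul]
    have h2 : (n : ℝ) ≤ 1 := by exact_mod_cast Nat.lt_succ_iff.1 hn
    have : 0 ≤ (n : ℝ) * δ + 2 * n * ε +
      2 * σ * √(6 * (Fintype.card S : ℝ) * n * Real.log n) := by positivity
    linarith
  · have hn' : (2 : ℝ) ≤ n := by exact_mod_cast hn
    -- The good event is an intersection over possibly uncountably many contexts and is only
    -- null-measurable; a measurable subset of full measure in it serves as `G`.
    obtain ⟨G, hGs, hG, hGae⟩ := hmeas.exists_measurable_subset_ae_eq
    have hδG : prior.snd.real Gᶜ ≤ δ := by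
      rw [probReal_compl_eq_one_sub hG, measureReal_congr hGae]
      linarith
    -- This absorbs the `1` of `2 log n + 1` into `6 log n`, the source of the constant `6`.
    have hlog : 1 ≤ 4 * Real.log n := by
      have := Real.log_le_log (by norm_num) hn'
      linarith [Real.log_two_gt_d9]
    obtain ⟨l, hl, hle⟩ := LatentBandit.exists_param_le (C := 2 * Real.log n + 1) σ.2 hN hn' le_rfl
      (by linarith)
    -- With `L = log n` the failures over all rounds cost `|S|`. The overshoots cost another `|S|`,
    -- and the spare term in the choice of `l` accounts for the third.
    have hexp : Real.exp (-Real.log n) * n = 1 := by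
      rw [Real.exp_neg, Real.exp_log (by linarith), inv_mul_cancel₀ (by linarith)]
    have hmain := LatentBandit.bayesRegret_le_of_params prior ctx hact hargmax hsubG hsubopt hosc
      (m := fun s a x => LatentBandit.marginalMean P prior a x s)
      (fun s => (LatentBandit.measurable_marginalMean P prior).comp (by fun_prop :
        Measurable fun p : Fin K × X => (p.1, p.2, s)))
      (fun s a x s' θ => LatentBandit.abs_marginalMean_sub_le P prior hosc a x s s' θ) hG hε.le
      (fun θ hθ s a x => hGs hθ a x s) hδG (Real.log_nonneg (by linarith : (1 : ℝ) ≤ n)) hl n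
    refine hmain.trans ?_
    have e1 : (n : ℝ) * (δ + Fintype.card S * Real.exp (-Real.log n) + ε) +
        (Fintype.card S + (ε + l * σ ^ 2) * n + Fintype.card S * (2 * Real.log n / l) +
          Fintype.card S * (Real.exp (-Real.log n) / l * n)) =
        n * δ + 2 * n * ε + Fintype.card S + Fintype.card S * (Real.exp (-Real.log n) * n) +
          l * σ ^ 2 * n + Fintype.card S * ((2 * Real.log n +
            Real.exp (-Real.log n) * n) / l) := by ring
    rw [e1, hexp]
    have hle' : l * (σ : ℝ) ^ 2 * n + Fintype.card S * ((2 * Real.log n + 1) / l) ≤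
      Fintype.card S + 2 * σ * √(6 * (Fintype.card S : ℝ) * n * Real.log n) := hle
    linarith
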